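/- Let $n\ge 1$ and let $\mathbf C\subseteq\{+1,-1\}^n$ be an inner code. Let $\vec X$ be uniformly distributed on $\mathbf C$, with equiprobable bits ($P(X_k=1)=\tfrac12$ for every $k$), and let $Z$ be the channel observation (any random variable on the same probability space). The a priori information comes from a Gaussian channel of signal to noise ratio $\gamma_{ap}\in[0,\infty)$: it is $\vec Y=\sqrt{\gamma_{ap}}\,\vec X+\vec N$, where $\vec N$ has independent standard Gaussian entries and is independent of $(\vec X,Z)$. The extrinsic log likelihood ratio of bit $k$ is $$L_{ext}(X_k)=\log\frac{P(X_k=1\mid Z,(Y_j)_{j\ne k})}{P(X_k=-1\mid Z,(Y_j)_{j\ne k})}\in[-\infty,\infty].$$ Suppose that the extrinsic information, too, can be represented as information from a Gaussian channel: for every $\gamma_{ap}\in[0,\infty)$ there is $\gamma_{ext}=\gamma_{ext}(\gamma_{ap})\in[0,\infty]$ such that for $x=\pm1$ the conditional law of $L_{ext}(X_k)$ given $X_k=x$, averaged over $k=1,\dots,n$ (for instance, for each $k$), is that of the log likelihood ratio at the output of a Gaussian channel of signal to noise ratio $\gamma_{ext}$, namely $\mathcal N(2\gamma_{ext}x,4\gamma_{ext})$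 (and the point mass at $x\cdot\infty$ if $\gamma_{ext}=\infty$). Complete the graph of $\gamma_{ap}\mapsto\gamma_{ext}(\gamma_{ap})$ by vertical segments at its jumps, including $\gamma_{ap}=0$ and $\gamma_{ap}=\infty$, to the transfer curve from $(0,0)$ to $(\infty,\infty)$, that is, the set of all $(a,e)\in[0,\infty]^2$ with $\gamma_{ext}(a')\le e$ for all $a'<a$ and $e\le\gamma_{ext}(a')$ for all $a'>a$ (with $a'$ finite). Let $\phi(\gamma)$ be the minimum mean squared error in estimating an equiprobable $X\in\{+1,-1\}$ from $\sqrt\gamma X+N$ with $N\sim\mathcal N(0,1)$ independent of $X$, and $\phi(\infty)=0$. Let $$R_{outer}^{max}=1-\frac1n H(\vec X\mid Z)$$ be the maximum supported outer code rate, where $H$ is the conditional entropy in bits. Then along the transfer curve $\gamma_{ap}$ can be expressed as a function of $\gamma_{ext}\in[0,\infty)$, with values in $[0,\infty]$, and for every such choice the function $\gamma_{ext}\mapsto\phi(\gamma_{ap}+\gamma_{ext})$ is integrable on $(0,\infty)$ and $$R_{outer}^{max}=\frac1{\ln 4}\int_0^\infty\phi(\gamma_{ap}+\gamma_{ext})\,d\gamma_{ext}.$$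 -/

import Mathlib

open MeasureTheory ProbabilityTheory
open scoped ENNReal NNReal

noncomputable section

/-- Minimum mean squared error in estimating the real random variable `X` from `Y`:
`E[(X - E[X | Y])²]`. -/
def mmse {Ω β : Type*} [MeasurableSpace Ω] [MeasurableSpace β] (μ : Measure Ω)
    (X : Ω → ℝ) (Y : Ω → β) : ℝ :=
  ∫ ω, (X ω - (μ[X | MeasurableSpace.comap Y inferInstance]) ω) ^ 2 ∂μ

/-- Law of an equiprobable `±1` bit. -/
def bitLaw : Measure ℝ :=
  (2⁻¹ : ℝ≥0∞) • Measure.dirac 1 + (2⁻¹ : ℝ≥0∞) • Measure.dirac (-1)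

/-- `φ(γ)`: the minimum mean squared error in estimating an equiprobable `±1` bit `X` from
`√γ X + N`, where `N` is standard Gaussian and independent of `X`; `φ(∞) = 0`. -/
def phi (γ : ℝ≥0∞) : ℝ :=
  if γ = ⊤ then 0
  else mmse (bitLaw.prod (gaussianReal 0 1)) (fun p : ℝ × ℝ => p.1)
    (fun p : ℝ × ℝ => √γ.toReal * p.1 + p.2)

/-- Output of the Gaussian channel with signal to noise ratio `γ`, input `X`, noise `N`. -/
def awgn {Ω : Type*} {n : ℕ} (X N : Ω → Fin n → ℝ) (γ : ℝ≥0) : Ω → Fin n → ℝ :=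
  fun ω i => √(γ : ℝ) * X ω i + N ω i

/-- Conditional entropy `H(X | Z)` in bits of a random variable `X` with values in the finite
set `C`. -/
def condEntropyBits {Ω α β : Type*} [MeasurableSpace Ω] [MeasurableSpace β] (μ : Measure Ω)
    (C : Finset α) (X : Ω → α) (Z : Ω → β) : ℝ :=
  (∫ ω, ∑ c ∈ C,
    Real.negMulLog ((μ⟦X ⁻¹' {c} | MeasurableSpace.comap Z inferInstance⟧) ω) ∂μ) / Real.log 2

/-- `R_outer^max = 1 - H(X | X ∈ C, Z) / n` for an inner code `C` of length `n` whose codeword `X`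
is observed through `Z`. -/
def maxOuterRate {Ω β : Type*} [MeasurableSpace Ω] [MeasurableSpace β] {n : ℕ} (μ : Measure Ω)
    (C : Finset (Fin n → ℝ)) (X : Ω → Fin n → ℝ) (Z : Ω → β) : ℝ :=
  1 - condEntropyBits μ C X Z / n

/-- Log likelihood ratio `log (P(B = 1 | V) / P(B = -1 | V))` of the bit `B` given `V`, with
values in `[-∞, ∞]`. -/
def llr {Ω β : Type*} [MeasurableSpace Ω] [MeasurableSpace β] (μ : Measure Ω)
    (B : Ω → ℝ) (V : Ω → β) (ω : Ω) : EReal :=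
  ENNReal.log
    (ENNReal.ofReal ((μ⟦B ⁻¹' {1} | MeasurableSpace.comap V inferInstance⟧) ω) /
      ENNReal.ofReal ((μ⟦B ⁻¹' {-1} | MeasurableSpace.comap V inferInstance⟧) ω))

/-- Extrinsic log likelihood ratio of bit `k`: the log likelihood ratio of `X k` given the
channel observation `Z` and the a priori observations `Y j` of all the other bits `j ≠ k`. -/
def extrinsicLLR {Ω β : Type*} [MeasurableSpace Ω] [MeasurableSpace β] {n : ℕ} (μ : Measure Ω)
    (X Y : Ω → Fin n → ℝ) (Z : Ω → β) (k : Fin n) : Ω → EReal :=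
  llr μ (fun ω => X ω k) (fun ω => (Z ω, fun j : {j : Fin n // j ≠ k} => Y ω j))

/-- Law of the extrinsic log likelihood ratio given that the bit equals `x`, averaged over the
bit positions. -/
def extrinsicLLRLaw {Ω β : Type*} [MeasurableSpace Ω] [MeasurableSpace β] {n : ℕ} (μ : Measure Ω)
    (X Y : Ω → Fin n → ℝ) (Z : Ω → β) (x : ℝ) : Measure EReal :=
  (n : ℝ≥0∞)⁻¹ • ∑ k : Fin n,
    (ProbabilityTheory.cond μ {ω | X ω k = x}).map (extrinsicLLR μ X Y Z k)

/-- Law of the log likelihood ratio of an equiprobable bit at the output of the Gaussian channel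
with signal to noise ratio `γ`, given that the bit is `x = ±1`: this is the law of
`2√γ (√γ x + N)`, i.e. `𝒩(m x, 2m)` with `m = 2γ`; for `γ = ∞` the bit is known. -/
def awgnLLRLaw (γ : ℝ≥0∞) (x : ℝ) : Measure EReal :=
  if γ = ⊤ then Measure.dirac (if x = 1 then ⊤ else ⊥)
  else (gaussianReal (2 * γ.toReal * x) (4 * γ.toNNReal)).map Real.toEReal

/-- The extrinsic information can be represented as information from Gaussian channels: when the
a priori observations come from a Gaussian channel with signal to noise ratio `γ`, the extrinsic
log likelihood ratios are distributed like those of a Gaussian channel with signal to noise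
ratio `γext γ`. -/
def GaussianExtrinsic {Ω β : Type*} [MeasurableSpace Ω] [MeasurableSpace β] {n : ℕ}
    (μ : Measure Ω) (X N : Ω → Fin n → ℝ) (Z : Ω → β) (γext : ℝ≥0 → ℝ≥0∞) : Prop :=
  ∀ γ : ℝ≥0, ∀ x : ℝ, x = 1 ∨ x = -1 →
    extrinsicLLRLaw μ X (awgn X N γ) Z x = awgnLLRLaw (γext γ) x

/-- The point `(a, e)` lies on the transfer curve, i.e. on the graph of `γext` completed by
vertical segments at its jumps to a curve from `(0, 0)` to `(∞, ∞)`: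
`γext(a-) ≤ e ≤ γext(a+)`, where `γext(0-) = 0` and `γext(∞+) = ∞`. -/
def OnTransferCurve (γext : ℝ≥0 → ℝ≥0∞) (a e : ℝ≥0∞) : Prop :=
  (∀ a' : ℝ≥0, (a' : ℝ≥0∞) < a → γext a' ≤ e) ∧ (∀ a' : ℝ≥0, a < (a' : ℝ≥0∞) → e ≤ γext a')

/-- `γap` expresses the a priori signal to noise ratio as a function of the extrinsic one, `t`,
along the transfer curve. -/
def IsAprioriSNR (γext : ℝ≥0 → ℝ≥0∞) (γap : ℝ → ℝ≥0∞) : Prop :=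
  ∀ t : ℝ, 0 ≤ t → OnTransferCurve γext (γap t) (ENNReal.ofReal t)

end

/-
Integrating the total mean squared error of the codeword, given the observation `Z` and a Gaussian
observation of signal to noise ratio `a`, over all `a` gives twice the entropy `H(X | Z)` in nats
(the I-MMSE relation). Given `Z` and all a priori observations, the log likelihood ratio of a bit is
the extrinsic one plus that of the bit's own a priori observation, so the Gaussian hypothesis turns
the average error per bit into `φ(γext(a) + a)`. Hence `∫ φ(γext(a) + a) da = 2 H(X | Z) / n` in
nats, and for a single bit the same relation gives `∫ φ = 2 log 2 = log 4`.

More a priori information lowers the Bhattacharyya parameter of a bit, so `γext` is monotone. Along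
the transfer curve of a monotone function, the push-forwards of `da` and `de` under `a + e` add up
to Lebesgue measure: each line `a + e = u` meets the curve in exactly one point. Therefore
`∫ φ(γap(e) + e) de = log 4 - 2 H(X | Z) / n`.
-/

noncomputable section

open Set Filter Topology Matrix

section ProductMeasures

variable {ι : Type*} [Fintype ι] {α : ι → Type*} [∀ i, MeasurableSpace (α i)]

lemma lintegral_pi_prod_eq_prod_lintegral (μ : ∀ i, Measure (α i)) [∀ i, IsProbabilityMeasure (μ i)]
    {f : ∀ i, α i → ℝ≥0∞} (hf : ∀ i, Measurable (f i)) :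
    ∫⁻ x, ∏ i, f i (x i) ∂Measure.pi μ = ∏ i, ∫⁻ x, f i x ∂μ i := by
  refine (lintegral_prod_eq_prod_lintegral_of_indepFun Finset.univ
    (fun i (x : ∀ i, α i) => f i (x i)) (iIndepFun_pi (fun i => (hf i).aemeasurable))
    (fun i => (hf i).comp (measurable_pi_apply i))).trans ?_
  exact Finset.prod_congr rfl fun i _ => (measurePreserving_eval μ i).lintegral_comp (hf i)

lemma pi_withDensity (μ : ∀ i, Measure (α i)) [∀ i, IsProbabilityMeasure (μ i)]
    {f : ∀ i, α i → ℝ≥0∞} (hf : ∀ i, Measurable (f i))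
    [∀ i, SigmaFinite ((μ i).withDensity (f i))] :
    Measure.pi (fun i => (μ i).withDensity (f i)) =
      (Measure.pi μ).withDensity (fun x => ∏ i, f i (x i)) := by
  refine Measure.pi_eq fun s hs => ?_
  have hindicator : ∀ x : ∀ i, α i, (univ.pi s).indicator (fun x => ∏ i, f i (x i)) x =
      ∏ i, (s i).indicator (f i) (x i) := by
    intro x
    by_cases hx : x ∈ univ.pi s
    · simp only [indicator_of_mem hx, indicator_of_mem (hx _ (mem_univ _))]
    · obtain ⟨i, hi⟩ : ∃ i, x i ∉ s i := by simpa using hx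
      rw [indicator_of_notMem hx]
      exact (Finset.prod_eq_zero (Finset.mem_univ i) (indicator_of_notMem hi _)).symm
  rw [withDensity_apply _ (MeasurableSet.univ_pi hs),
    ← lintegral_indicator (MeasurableSet.univ_pi hs)]
  simp_rw [hindicator, withDensity_apply _ (hs _), ← lintegral_indicator (hs _)]
  exact lintegral_pi_prod_eq_prod_lintegral μ fun i => (hf i).indicator (hs i)

end ProductMeasures

section GaussianNoise

lemma gaussianReal_eq_withDensity_exp (a : ℝ) :
    gaussianReal a 1 = (gaussianReal 0 1).withDensity
      (fun x => ENNReal.ofReal (Real.exp (a * x - a * a / 2))) := by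
  rw [gaussianReal_of_var_ne_zero _ one_ne_zero, gaussianReal_of_var_ne_zero _ one_ne_zero,
    ← withDensity_mul _ (measurable_gaussianPDF _ _) (by fun_prop)]
  congr 1
  ext x
  simp only [Pi.mul_apply, gaussianPDF]
  rw [← ENNReal.ofReal_mul (gaussianPDFReal_nonneg _ _ _)]
  simp only [gaussianPDFReal]
  rw [mul_assoc (√_)⁻¹, ← Real.exp_add]
  congr 3
  simp only [NNReal.coe_one]
  ring

lemma gaussianReal_map_rotate {r t : ℝ} (hrt : r ^ 2 + t ^ 2 = 1) :
    ((gaussianReal 0 1).prod (gaussianReal 0 1)).map (fun p : ℝ × ℝ => r * p.1 + t * p.2) =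
      gaussianReal 0 1 := by
  have hsplit : ((gaussianReal 0 1).prod (gaussianReal 0 1)).map
      (fun p : ℝ × ℝ => r * p.1 + t * p.2) =
      ((gaussianReal 0 1).map (r * ·)) ∗ ((gaussianReal 0 1).map (t * ·)) := by
    rw [Measure.conv, Measure.map_prod_map _ _ (by fun_prop) (by fun_prop),
      Measure.map_map (by fun_prop) (by fun_prop)]
    rfl
  rw [hsplit, gaussianReal_map_const_mul, gaussianReal_map_const_mul,
    gaussianReal_conv_gaussianReal]
  congr 1
  · ring
  · ext; simpa using hrt

variable {ι : Type*} [Fintype ι]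

/-- The standard Gaussian measure on `ι → ℝ`: the law of a noise vector with independent
standard Gaussian entries. -/
def stdGauss (ι : Type*) [Fintype ι] : Measure (ι → ℝ) :=
  Measure.pi (fun _ => gaussianReal 0 1)

instance : IsProbabilityMeasure (stdGauss ι) :=
  inferInstanceAs (IsProbabilityMeasure (Measure.pi _))

/-- Density of the translate of the standard Gaussian measure by `a` with respect to the
standard Gaussian measure itself (`stdGauss_map_add`): the likelihood ratio of a Gaussian
channel. -/
def shiftDensity (a w : ι → ℝ) : ℝ :=
  Real.exp (a ⬝ᵥ w - a ⬝ᵥ a / 2)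

lemma shiftDensity_pos (a w : ι → ℝ) : 0 < shiftDensity a w := Real.exp_pos _

@[simp]
lemma shiftDensity_zero (w : ι → ℝ) : shiftDensity 0 w = 1 := by simp [shiftDensity]

@[fun_prop]
lemma continuous_shiftDensity :
    Continuous (fun p : (ι → ℝ) × (ι → ℝ) => shiftDensity p.1 p.2) := by
  unfold shiftDensity dotProduct
  fun_prop

@[fun_prop]
lemma measurable_shiftDensity {α : Type*} [MeasurableSpace α] {a w : α → ι → ℝ}
    (ha : Measurable a) (hw : Measurable w) : Measurable fun x => shiftDensity (a x) (w x) :=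
  continuous_shiftDensity.measurable.comp (ha.prodMk hw)

lemma shiftDensity_add (a b w : ι → ℝ) :
    shiftDensity a (b + w) = shiftDensity (a - b) w * shiftDensity b (b + w) := by
  unfold shiftDensity
  rw [← Real.exp_add]
  congr 1
  simp only [dotProduct_add, sub_dotProduct, dotProduct_sub, dotProduct_comm b a]
  ring

lemma dotProduct_self_nonneg (a : ι → ℝ) : 0 ≤ a ⬝ᵥ a := by
  simpa using dotProduct_star_self_nonneg a

lemma shiftDensity_le_exp (a w : ι → ℝ) : shiftDensity a w ≤ Real.exp (w ⬝ᵥ w / 2) := by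
  have hsq := dotProduct_self_nonneg (w - a)
  rw [sub_dotProduct, dotProduct_sub, dotProduct_sub, dotProduct_comm w a] at hsq
  exact Real.exp_le_exp.2 (by linarith)

lemma stdGauss_map_add (a : ι → ℝ) :
    (stdGauss ι).map (a + ·) =
      (stdGauss ι).withDensity (fun w => ENNReal.ofReal (shiftDensity a w)) := by
  have hmean : (stdGauss ι).map (a + ·) = Measure.pi (fun i => gaussianReal (a i) 1) := by
    have := Measure.pi_map_pi (μ := fun _ : ι => gaussianReal 0 1)
      (f := fun i x => a i + x) (hμ := fun i => by
        rw [gaussianReal_map_const_add]; infer_instance) (fun i => by fun_prop)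
    simp only [gaussianReal_map_const_add, zero_add] at this
    exact this
  have hprod : ∀ w : ι → ℝ, ENNReal.ofReal (shiftDensity a w) =
      ∏ i, ENNReal.ofReal (Real.exp (a i * w i - a i * a i / 2)) := by
    intro w
    rw [← ENNReal.ofReal_prod_of_nonneg (fun _ _ => (Real.exp_pos _).le), ← Real.exp_sum,
      Finset.sum_sub_distrib, ← Finset.sum_div]
    rfl
  have hsigma : ∀ i, SigmaFinite ((gaussianReal 0 1).withDensity
      (fun x => ENNReal.ofReal (Real.exp (a i * x - a i * a i / 2)))) := fun i => by
    rw [← gaussianReal_eq_withDensity_exp]; infer_instance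
  simp_rw [hmean, hprod, gaussianReal_eq_withDensity_exp (a _)]
  exact pi_withDensity _ fun i => by fun_prop

lemma lintegral_stdGauss_add (a : ι → ℝ) {F : (ι → ℝ) → ℝ≥0∞} (hF : Measurable F) :
    ∫⁻ w, F (a + w) ∂stdGauss ι =
      ∫⁻ w, ENNReal.ofReal (shiftDensity a w) * F w ∂stdGauss ι := by
  rw [← lintegral_map hF (measurable_const_add a), stdGauss_map_add,
    lintegral_withDensity_eq_lintegral_mul _ (by fun_prop) hF]
  rfl

lemma integral_stdGauss_add (a : ι → ℝ) (F : (ι → ℝ) → ℝ) :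
    ∫ w, F (a + w) ∂stdGauss ι = ∫ w, shiftDensity a w * F w ∂stdGauss ι := by
  have hmap := integral_map_equiv (μ := stdGauss ι) (MeasurableEquiv.addLeft a) F
  simp only [MeasurableEquiv.coe_addLeft] at hmap
  rw [← hmap, stdGauss_map_add,
    integral_withDensity_eq_integral_toReal_smul (by fun_prop) (by simp)]
  simp only [ENNReal.toReal_ofReal (shiftDensity_pos _ _).le, smul_eq_mul]

lemma integrable_stdGauss_add_iff (a : ι → ℝ) (F : (ι → ℝ) → ℝ) :
    Integrable (fun w => F (a + w)) (stdGauss ι) ↔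
      Integrable (fun w => shiftDensity a w * F w) (stdGauss ι) := by
  have hmap := integrable_map_equiv (μ := stdGauss ι) (MeasurableEquiv.addLeft a) F
  simp only [MeasurableEquiv.coe_addLeft] at hmap
  change Integrable (F ∘ (a + ·)) _ ↔ _
  rw [← hmap, stdGauss_map_add,
    integrable_withDensity_iff_integrable_smul' (by fun_prop) (by simp)]
  simp only [ENNReal.toReal_ofReal (shiftDensity_pos _ _).le, smul_eq_mul]

lemma lintegral_shiftDensity (a : ι → ℝ) :
    ∫⁻ w, ENNReal.ofReal (shiftDensity a w) ∂stdGauss ι = 1 := by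
  simpa using (lintegral_stdGauss_add a (F := fun _ => 1) measurable_const).symm

lemma stdGauss_map_rotate {r t : ℝ} (hrt : r ^ 2 + t ^ 2 = 1) :
    ((stdGauss ι).prod (stdGauss ι)).map (fun p => r • p.1 + t • p.2) = stdGauss ι := by
  have hcoord := gaussianReal_map_rotate hrt
  have hpairs := measurePreserving_arrowProdEquivProdArrow ℝ ℝ ι (fun _ => gaussianReal 0 1)
    (fun _ => gaussianReal 0 1)
  have hpi := Measure.pi_map_pi (μ := fun _ : ι => (gaussianReal 0 1).prod (gaussianReal 0 1))
    (f := fun _ p => r * p.1 + t * p.2) (hμ := fun _ => by rw [hcoord]; infer_instance)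
    (fun _ => by fun_prop)
  rw [hcoord] at hpi
  unfold stdGauss
  rw [← hpairs.map_eq, Measure.map_map (by fun_prop) hpairs.measurable]
  exact hpi

lemma lintegral_stdGauss_rotate {r t : ℝ} (hrt : r ^ 2 + t ^ 2 = 1) {F : (ι → ℝ) → ℝ≥0∞}
    (hF : Measurable F) :
    ∫⁻ w, ∫⁻ v, F (r • w + t • v) ∂stdGauss ι ∂stdGauss ι = ∫⁻ w, F w ∂stdGauss ι := by
  rw [← lintegral_prod (f := fun p : (ι → ℝ) × (ι → ℝ) => F (r • p.1 + t • p.2))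
    (hf := by fun_prop), ← lintegral_map hF (by fun_prop), stdGauss_map_rotate hrt]

lemma memLp_eval_stdGauss (i : ι) : MemLp (fun w : ι → ℝ => w i) 2 (stdGauss ι) :=
  (memLp_id_gaussianReal' 2 (by simp)).comp_measurePreserving (measurePreserving_eval _ i)

end GaussianNoise

section WeightedAverages

variable {α β : Type*} [MeasurableSpace β] {t : Finset α} {w : α → ℝ}

lemma sum_mul_centerMass (hw : ∀ a ∈ t, 0 ≤ w a) (f : α → ℝ) :
    (∑ a ∈ t, w a) * t.centerMass w f = ∑ a ∈ t, w a * f a := by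
  rcases (Finset.sum_nonneg hw).eq_or_lt with hsum | hsum
  · rw [← hsum, zero_mul]
    refine (Finset.sum_eq_zero fun a ha => ?_).symm
    rw [(Finset.sum_eq_zero_iff_of_nonneg hw).1 hsum.symm a ha, zero_mul]
  · rw [Finset.centerMass, smul_eq_mul, mul_inv_cancel_left₀ hsum.ne']
    rfl

lemma sum_mul_sub_centerMass (hw : ∀ a ∈ t, 0 ≤ w a) (f : α → ℝ) :
    ∑ a ∈ t, w a * (f a - t.centerMass w f) = 0 := by
  simp only [mul_sub, Finset.sum_sub_distrib, ← Finset.sum_mul, sum_mul_centerMass hw f, sub_self]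

lemma abs_centerMass_le (hw : ∀ a ∈ t, 0 ≤ w a) (f : α → ℝ) :
    |t.centerMass w f| ≤ ∑ a ∈ t, |f a| := by
  have hsum : 0 ≤ ∑ a ∈ t, w a := Finset.sum_nonneg hw
  calc |t.centerMass w f| = (∑ a ∈ t, w a)⁻¹ * |∑ a ∈ t, w a * f a| := by
        rw [Finset.centerMass, smul_eq_mul, abs_mul, abs_of_nonneg (inv_nonneg.2 hsum)]
        rfl
    _ ≤ (∑ a ∈ t, w a)⁻¹ * ((∑ a ∈ t, w a) * ∑ a ∈ t, |f a|) := by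
        gcongr
        rw [Finset.mul_sum]
        refine (Finset.abs_sum_le_sum_abs _ _).trans (Finset.sum_le_sum fun a ha => ?_)
        rw [abs_mul, abs_of_nonneg (hw a ha)]
        gcongr
        exact Finset.single_le_sum hw ha
    _ ≤ ∑ a ∈ t, |f a| := by
        rw [← mul_assoc]
        exact mul_le_of_le_one_left (Finset.sum_nonneg fun _ _ => abs_nonneg _) inv_mul_le_one

lemma measurable_centerMass {w : β → α → ℝ} (hw : ∀ a ∈ t, Measurable fun b => w b a)
    (f : α → ℝ) : Measurable fun b => t.centerMass (w b) f := by
  unfold Finset.centerMass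
  exact (Finset.measurable_sum _ hw).inv.smul
    (Finset.measurable_sum _ fun a ha => (hw a ha).smul_const (f a))

/-- `p` is a probability mass function on the finite set `t`; the values of `p` outside `t` are
irrelevant. -/
structure IsProbWeights (t : Finset α) (p : α → ℝ) : Prop where
  nonneg : ∀ a ∈ t, 0 ≤ p a
  sum_eq_one : ∑ a ∈ t, p a = 1

lemma IsProbWeights.sum_mul_pos {p : α → ℝ} (hp : IsProbWeights t p) {f : α → ℝ}
    (hf : ∀ a ∈ t, 0 < f a) : 0 < ∑ a ∈ t, p a * f a := by
  obtain ⟨a, ha, hpa⟩ : ∃ a ∈ t, p a ≠ 0 :=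
    Finset.exists_ne_zero_of_sum_ne_zero (by rw [hp.sum_eq_one]; exact one_ne_zero)
  exact Finset.sum_pos' (fun b hb => mul_nonneg (hp.nonneg b hb) (hf b hb).le)
    ⟨a, ha, mul_pos ((hp.nonneg a ha).lt_of_ne' hpa) (hf a ha)⟩

end WeightedAverages

section GaussianChannel

variable {ι : Type*} [Fintype ι]

/-- Joint density of the input `c` and the output `y` of the Gaussian channel of amplitude `s`
with input distribution `p`, relative to counting measure times `stdGauss`; as a function of `c`
these are the unnormalized posterior weights. -/
def bayesWeight (p : (ι → ℝ) → ℝ) (s : ℝ) (y c : ι → ℝ) : ℝ :=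
  p c * shiftDensity (s • c) y

/-- Posterior average `E[f(X) | Y = y]` for the Gaussian channel `Y = s X + N`, where `X` has
distribution `p` on `C`. -/
def postAvg (C : Finset (ι → ℝ)) (p : (ι → ℝ) → ℝ) (s : ℝ) (f : (ι → ℝ) → ℝ) (y : ι → ℝ) : ℝ :=
  C.centerMass (bayesWeight p s y) f

/-- Expectation `E[F(X, Y)]` for the Gaussian channel `Y = s X + N`, where `X` has distribution
`p` on `C`. -/
def channelExp (C : Finset (ι → ℝ)) (p : (ι → ℝ) → ℝ) (s : ℝ)
    (F : (ι → ℝ) → (ι → ℝ) → ℝ) : ℝ :=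
  ∑ c ∈ C, p c * ∫ w, F c (s • c + w) ∂stdGauss ι

/-- Minimum mean squared error in estimating the `i`-th entry of the input of the Gaussian channel
of amplitude `s` from the output vector. -/
def channelMMSE (C : Finset (ι → ℝ)) (p : (ι → ℝ) → ℝ) (s : ℝ) (i : ι) : ℝ :=
  channelExp C p s fun c y => (c i - postAvg C p s (fun d => d i) y) ^ 2

/-- Information density `log (f(y | c) / f(y))` of the Gaussian channel, in nats. -/
def infoDensity (C : Finset (ι → ℝ)) (p : (ι → ℝ) → ℝ) (s : ℝ) (c y : ι → ℝ) : ℝ :=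
  Real.log (shiftDensity (s • c) y / ∑ d ∈ C, bayesWeight p s y d)

/-- Mutual information, in nats, between the input and the output of the Gaussian channel. -/
def mutualInfo (C : Finset (ι → ℝ)) (p : (ι → ℝ) → ℝ) (s : ℝ) : ℝ :=
  channelExp C p s (infoDensity C p s)

variable {C : Finset (ι → ℝ)} {p : (ι → ℝ) → ℝ}

lemma IsProbWeights.bayesWeight_nonneg (hp : IsProbWeights C p) (s : ℝ) (y : ι → ℝ) :
    ∀ d ∈ C, 0 ≤ bayesWeight p s y d :=
  fun d hd => mul_nonneg (hp.nonneg d hd) (shiftDensity_pos _ _).le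

lemma channelMMSE_nonneg (hp : IsProbWeights C p) (s : ℝ) (i : ι) : 0 ≤ channelMMSE C p s i :=
  Finset.sum_nonneg fun c hc => mul_nonneg (hp.nonneg c hc) (integral_nonneg fun _ => sq_nonneg _)

lemma measurable_postAvg (s : ℝ) (f : (ι → ℝ) → ℝ) : Measurable (postAvg C p s f) :=
  measurable_centerMass (fun d _ => by unfold bayesWeight; fun_prop) f

lemma abs_postAvg_le (hp : IsProbWeights C p) (s : ℝ) (f : (ι → ℝ) → ℝ) (y : ι → ℝ) :
    |postAvg C p s f y| ≤ ∑ d ∈ C, |f d| :=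
  abs_centerMass_le (hp.bayesWeight_nonneg s y) f

lemma integrable_sub_postAvg_mul (hp : IsProbWeights C p) (s : ℝ) (f : (ι → ℝ) → ℝ) (c : ι → ℝ)
    {g : (ι → ℝ) → ℝ} (hg : Integrable (fun w => g (s • c + w)) (stdGauss ι)) :
    Integrable (fun w => (f c - postAvg C p s f (s • c + w)) * g (s • c + w)) (stdGauss ι) := by
  have hmeas : Measurable fun w => f c - postAvg C p s f (s • c + w) :=
    measurable_const.sub ((measurable_postAvg s f).comp (measurable_const_add _))
  refine hg.bdd_mul (c := |f c| + ∑ d ∈ C, |f d|) hmeas.aestronglyMeasurable (ae_of_all _ ?_)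
  intro w
  rw [Real.norm_eq_abs]
  exact (abs_sub _ _).trans (by gcongr; exact abs_postAvg_le hp s f _)

lemma channelExp_sub_postAvg_mul (hp : IsProbWeights C p) (s : ℝ) (f : (ι → ℝ) → ℝ)
    {g : (ι → ℝ) → ℝ} (hg : ∀ c ∈ C, Integrable (fun w => g (s • c + w)) (stdGauss ι)) :
    channelExp C p s (fun c y => (f c - postAvg C p s f y) * g y) = 0 := by
  have hint : ∀ c ∈ C, Integrable
      (fun y => p c * (shiftDensity (s • c) y * ((f c - postAvg C p s f y) * g y)))
      (stdGauss ι) := fun c hc =>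
    ((integrable_stdGauss_add_iff (s • c) fun y => (f c - postAvg C p s f y) * g y).1
      (integrable_sub_postAvg_mul hp s f c (hg c hc))).const_mul _
  calc channelExp C p s (fun c y => (f c - postAvg C p s f y) * g y)
      = ∑ c ∈ C, ∫ y, p c * (shiftDensity (s • c) y * ((f c - postAvg C p s f y) * g y))
          ∂stdGauss ι := Finset.sum_congr rfl fun c _ => by
        rw [integral_stdGauss_add (s • c) fun y => (f c - postAvg C p s f y) * g y,
          integral_const_mul]
    _ = ∫ y, (∑ c ∈ C, bayesWeight p s y c * (f c - postAvg C p s f y)) * g y ∂stdGauss ι := by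
        rw [← integral_finsetSum _ hint]
        congr with y
        rw [Finset.sum_mul]
        exact Finset.sum_congr rfl fun c _ => by rw [bayesWeight]; ring
    _ = 0 := by
        simp only [postAvg, sum_mul_sub_centerMass (hp.bayesWeight_nonneg s _), zero_mul,
          integral_zero]

lemma channelExp_add {s : ℝ} {F G : (ι → ℝ) → (ι → ℝ) → ℝ}
    (hF : ∀ c ∈ C, Integrable (fun w => F c (s • c + w)) (stdGauss ι))
    (hG : ∀ c ∈ C, Integrable (fun w => G c (s • c + w)) (stdGauss ι)) :
    channelExp C p s (fun c y => F c y + G c y) = channelExp C p s F + channelExp C p s G := by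
  unfold channelExp
  rw [← Finset.sum_add_distrib]
  exact Finset.sum_congr rfl fun c hc => by rw [integral_add (hF c hc) (hG c hc), mul_add]

lemma channelExp_finsetSum {κ : Type*} (t : Finset κ) {s : ℝ} {F : κ → (ι → ℝ) → (ι → ℝ) → ℝ}
    (hF : ∀ k ∈ t, ∀ c ∈ C, Integrable (fun w => F k c (s • c + w)) (stdGauss ι)) :
    channelExp C p s (fun c y => ∑ k ∈ t, F k c y) = ∑ k ∈ t, channelExp C p s (F k) := by
  unfold channelExp
  rw [Finset.sum_comm]
  refine Finset.sum_congr rfl fun c hc => ?_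
  rw [integral_finsetSum _ fun k hk => hF k hk c hc, Finset.mul_sum]

lemma integrable_eval_channel (s : ℝ) (c : ι → ℝ) (i : ι) :
    Integrable (fun w => (s • c + w) i) (stdGauss ι) :=
  (integrable_const _).add ((memLp_eval_stdGauss i).integrable one_le_two)

end GaussianChannel

section InformationDensity

variable {ι : Type*} [Fintype ι] {C : Finset (ι → ℝ)} {p : (ι → ℝ) → ℝ}

lemma shiftDensity_smul (s : ℝ) (a w : ι → ℝ) :
    shiftDensity (s • a) w = Real.exp (s * (a ⬝ᵥ w) - s ^ 2 * (a ⬝ᵥ a / 2)) := by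
  simp only [shiftDensity, smul_dotProduct, dotProduct_smul, smul_eq_mul]
  congr 1
  ring

lemma hasDerivAt_shiftDensity_smul (a w : ι → ℝ) (s : ℝ) :
    HasDerivAt (fun s => shiftDensity (s • a) w)
      (shiftDensity (s • a) w * (a ⬝ᵥ w - s * (a ⬝ᵥ a))) s := by
  simp only [shiftDensity_smul]
  refine (((hasDerivAt_id' s).mul_const (a ⬝ᵥ w)).fun_sub
    ((hasDerivAt_pow 2 s).mul_const (a ⬝ᵥ a / 2))).exp.congr_deriv ?_
  ring

lemma tendsto_shiftDensity_smul_atTop {a : ι → ℝ} (ha : a ≠ 0) (w : ι → ℝ) :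
    Tendsto (fun s : ℝ => shiftDensity (s • a) w) atTop (𝓝 0) := by
  have ha2 : -(a ⬝ᵥ a / 2) < 0 := by
    have : 0 < a ⬝ᵥ a :=
      (dotProduct_self_nonneg a).lt_of_ne' (dotProduct_self_eq_zero.not.2 ha)
    linarith
  simp only [shiftDensity_smul]
  refine Real.tendsto_exp_atBot.comp ?_
  refine (tendsto_id.atTop_mul_atBot₀ (tendsto_atBot_add_const_right atTop (a ⬝ᵥ w)
    (tendsto_id.atTop_mul_const_of_neg ha2))).congr fun s => ?_
  simp only [id_eq]
  ring

lemma bayesWeight_add (p : (ι → ℝ) → ℝ) (s : ℝ) (c w d : ι → ℝ) :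
    bayesWeight p s (s • c + w) d =
      p d * shiftDensity (s • (d - c)) w * shiftDensity (s • c) (s • c + w) := by
  rw [bayesWeight, shiftDensity_add, smul_sub, mul_assoc]

lemma infoDensity_add (C : Finset (ι → ℝ)) (p : (ι → ℝ) → ℝ) (s : ℝ) (c w : ι → ℝ) :
    infoDensity C p s c (s • c + w) =
      -Real.log (∑ d ∈ C, p d * shiftDensity (s • (d - c)) w) := by
  simp only [infoDensity, bayesWeight_add, ← Finset.sum_mul]
  rw [div_mul_cancel_right₀ (shiftDensity_pos _ _).ne', Real.log_inv]

lemma postAvg_add (C : Finset (ι → ℝ)) (p : (ι → ℝ) → ℝ) (s : ℝ) (f : (ι → ℝ) → ℝ)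
    (c w : ι → ℝ) :
    postAvg C p s f (s • c + w) =
      C.centerMass (fun d => p d * shiftDensity (s • (d - c)) w) f := by
  have hweights : bayesWeight p s (s • c + w) =
      shiftDensity (s • c) (s • c + w) • fun d => p d * shiftDensity (s • (d - c)) w :=
    funext fun d => by rw [bayesWeight_add, Pi.smul_apply, smul_eq_mul, mul_comm]
  rw [postAvg, hweights, Finset.centerMass_smul_left (hc := (shiftDensity_pos _ _).ne')]

lemma hasDerivAt_infoDensity (hp : IsProbWeights C p) (c w : ι → ℝ) (s : ℝ) :
    HasDerivAt (fun s => infoDensity C p s c (s • c + w))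
      (-postAvg C p s (fun d => (d - c) ⬝ᵥ w - s * ((d - c) ⬝ᵥ (d - c))) (s • c + w)) s := by
  simp only [infoDensity_add, postAvg_add]
  have hsum := HasDerivAt.fun_sum fun d (_ : d ∈ C) =>
    (hasDerivAt_shiftDensity_smul (d - c) w s).const_mul (p d)
  refine (hsum.log (hp.sum_mul_pos fun d _ => shiftDensity_pos _ _).ne').fun_neg.congr_deriv ?_
  simp only [Finset.centerMass, smul_eq_mul, div_eq_inv_mul, mul_assoc]

lemma measurable_infoDensity_add (s : ℝ) (c : ι → ℝ) :
    Measurable fun w => infoDensity C p s c (s • c + w) := by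
  simp only [infoDensity_add]
  fun_prop

lemma infoDensity_add_le (hp : IsProbWeights C p) {c : ι → ℝ} (hc : c ∈ C) (hpc : 0 < p c) (s : ℝ)
    (w : ι → ℝ) : infoDensity C p s c (s • c + w) ≤ -Real.log (p c) := by
  rw [infoDensity_add]
  refine neg_le_neg (Real.log_le_log hpc ?_)
  have hle := Finset.single_le_sum (f := fun d => p d * shiftDensity (s • (d - c)) w)
    (fun d hd => mul_nonneg (hp.nonneg d hd) (shiftDensity_pos _ _).le) hc
  simpa using hle

lemma neg_dotProduct_le_infoDensity_add (hp : IsProbWeights C p) (s : ℝ) (c w : ι → ℝ) :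
    -(w ⬝ᵥ w / 2) ≤ infoDensity C p s c (s • c + w) := by
  rw [infoDensity_add, neg_le_neg_iff,
    Real.log_le_iff_le_exp (hp.sum_mul_pos fun d _ => shiftDensity_pos _ _)]
  calc ∑ d ∈ C, p d * shiftDensity (s • (d - c)) w
      ≤ ∑ d ∈ C, p d * Real.exp (w ⬝ᵥ w / 2) := Finset.sum_le_sum fun d hd =>
        mul_le_mul_of_nonneg_left (shiftDensity_le_exp _ _) (hp.nonneg d hd)
    _ = Real.exp (w ⬝ᵥ w / 2) := by rw [← Finset.sum_mul, hp.sum_eq_one, one_mul]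

lemma abs_infoDensity_add_le (hp : IsProbWeights C p) {c : ι → ℝ} (hc : c ∈ C) (hpc : 0 < p c)
    (s : ℝ) (w : ι → ℝ) :
    |infoDensity C p s c (s • c + w)| ≤ w ⬝ᵥ w / 2 + |Real.log (p c)| := by
  have hlower := neg_dotProduct_le_infoDensity_add hp s c w
  have hupper := infoDensity_add_le hp hc hpc s w
  have hnorm := dotProduct_self_nonneg w
  have := neg_le_abs (Real.log (p c))
  rw [abs_le]
  constructor <;> linarith [abs_nonneg (Real.log (p c))]

lemma integrable_dotProduct_self_add_const (K : ℝ) :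
    Integrable (fun w => w ⬝ᵥ w / 2 + K) (stdGauss ι) := by
  have hsq : ∀ i : ι, Integrable (fun w : ι → ℝ => w i * w i) (stdGauss ι) := fun i =>
    (memLp_eval_stdGauss i).integrable_mul (memLp_eval_stdGauss i)
  exact ((integrable_finsetSum _ fun i _ => hsq i).div_const 2).add (integrable_const K)

lemma integrable_infoDensity_add (hp : IsProbWeights C p) {c : ι → ℝ} (hc : c ∈ C)
    (hpc : 0 < p c) (s : ℝ) :
    Integrable (fun w => infoDensity C p s c (s • c + w)) (stdGauss ι) :=
  (integrable_dotProduct_self_add_const |Real.log (p c)|).mono'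
    (measurable_infoDensity_add s c).aestronglyMeasurable
    (ae_of_all _ fun w => abs_infoDensity_add_le hp hc hpc s w)

lemma tendsto_infoDensity_add (hpc : 0 < p c) (hc : c ∈ C) (w : ι → ℝ) :
    Tendsto (fun s => infoDensity C p s c (s • c + w)) atTop (𝓝 (-Real.log (p c))) := by
  classical
  simp only [infoDensity_add]
  refine (Tendsto.log ?_ hpc.ne').neg
  have hterm : ∀ d ∈ C, Tendsto (fun s : ℝ => p d * shiftDensity (s • (d - c)) w) atTop
      (𝓝 (if d = c then p c else 0)) := by
    intro d _
    split_ifs with hdc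
    · simp [hdc]
    · simpa using (tendsto_shiftDensity_smul_atTop (sub_ne_zero.2 hdc) w).const_mul (p d)
  simpa [hc] using tendsto_finsetSum C hterm

end InformationDensity

section MutualInformationDerivative

variable {ι : Type*} [Fintype ι] {C : Finset (ι → ℝ)} {p : (ι → ℝ) → ℝ}

/-- Contribution of the `i`-th entry to the derivative of the information density along
`y = s c + w`. -/
def infoDensityDeriv (C : Finset (ι → ℝ)) (p : (ι → ℝ) → ℝ) (s : ℝ) (i : ι) (c y : ι → ℝ) : ℝ :=
  (c i - postAvg C p s (fun d => d i) y) * y i +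
    s * (postAvg C p s (fun d => d i ^ 2) y - c i * postAvg C p s (fun d => d i) y)

lemma neg_postAvg_eq_sum_infoDensityDeriv (hp : IsProbWeights C p) (s : ℝ) (c w : ι → ℝ) :
    -postAvg C p s (fun d => (d - c) ⬝ᵥ w - s * ((d - c) ⬝ᵥ (d - c))) (s • c + w) =
      ∑ i, infoDensityDeriv C p s i c (s • c + w) := by
  set y := s • c + w with hy
  have hweights := hp.bayesWeight_nonneg s y
  have hsum : ∑ d ∈ C, bayesWeight p s y d ≠ 0 :=
    (hp.sum_mul_pos fun d _ => shiftDensity_pos _ _).ne'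
  refine mul_left_cancel₀ hsum ?_
  have havg : ∀ f, (∑ d ∈ C, bayesWeight p s y d) * postAvg C p s f y =
      ∑ d ∈ C, bayesWeight p s y d * f d := sum_mul_centerMass hweights
  calc (∑ d ∈ C, bayesWeight p s y d) *
        -postAvg C p s (fun d => (d - c) ⬝ᵥ w - s * ((d - c) ⬝ᵥ (d - c))) y
      = ∑ i, ∑ d ∈ C, bayesWeight p s y d *
          ((c i - d i) * y i + s * (d i ^ 2 - c i * d i)) := by
        rw [mul_neg, havg, Finset.sum_comm, ← Finset.sum_neg_distrib]
        refine Finset.sum_congr rfl fun d _ => ?_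
        simp only [dotProduct, Pi.sub_apply, hy, Pi.add_apply, Pi.smul_apply, smul_eq_mul]
        rw [← Finset.mul_sum, Finset.mul_sum, ← Finset.sum_sub_distrib, ← mul_neg,
          ← Finset.sum_neg_distrib]
        exact congrArg _ (Finset.sum_congr rfl fun i _ => by ring)
    _ = ∑ i, (∑ d ∈ C, bayesWeight p s y d) * infoDensityDeriv C p s i c y := by
        refine Finset.sum_congr rfl fun i _ => ?_
        rw [infoDensityDeriv, mul_add, ← mul_assoc, mul_sub, mul_left_comm _ s, mul_sub,
          mul_left_comm _ (c i), havg, havg, Finset.sum_mul, Finset.mul_sum,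
          ← Finset.sum_sub_distrib, ← Finset.sum_sub_distrib, Finset.sum_mul, Finset.mul_sum,
          ← Finset.sum_add_distrib]
        exact Finset.sum_congr rfl fun d _ => by ring
    _ = (∑ d ∈ C, bayesWeight p s y d) * ∑ i, infoDensityDeriv C p s i c y :=
        (Finset.mul_sum _ _ _).symm

lemma integrable_postAvg_add (hp : IsProbWeights C p) (s : ℝ) (f : (ι → ℝ) → ℝ) (c : ι → ℝ) :
    Integrable (fun w => postAvg C p s f (s • c + w)) (stdGauss ι) :=
  Integrable.of_bound ((measurable_postAvg s f).comp
    (measurable_const_add _)).aestronglyMeasurable (∑ d ∈ C, |f d|)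
    (ae_of_all _ fun _ => abs_postAvg_le hp s f _)

lemma integrable_sq_sub_postAvg_add (hp : IsProbWeights C p) (s : ℝ) (f : (ι → ℝ) → ℝ)
    (c : ι → ℝ) :
    Integrable (fun w => (f c - postAvg C p s f (s • c + w)) ^ 2) (stdGauss ι) := by
  simp only [sq]
  exact integrable_sub_postAvg_mul hp s f c (g := fun y => f c - postAvg C p s f y)
    ((integrable_const _).sub (integrable_postAvg_add hp s f c))

lemma infoDensityDeriv_eq (s : ℝ) (i : ι) (c y : ι → ℝ) :
    infoDensityDeriv C p s i c y = s * (c i - postAvg C p s (fun d => d i) y) ^ 2 +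
      ((c i - postAvg C p s (fun d => d i) y) * (y i + s * postAvg C p s (fun d => d i) y) +
        (c i ^ 2 - postAvg C p s (fun d => d i ^ 2) y) * -s) := by
  rw [infoDensityDeriv]
  ring

section Integrability

variable (hp : IsProbWeights C p) (s : ℝ) (i : ι) (c : ι → ℝ)
include hp

lemma integrable_eval_add_mul_postAvg :
    Integrable (fun w => (s • c + w) i + s * postAvg C p s (fun d => d i) (s • c + w))
      (stdGauss ι) :=
  (integrable_eval_channel s c i).add ((integrable_postAvg_add hp s _ c).const_mul s)

lemma integrable_orthogonalTerms :
    Integrable (fun w =>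
      (c i - postAvg C p s (fun d => d i) (s • c + w)) *
        ((s • c + w) i + s * postAvg C p s (fun d => d i) (s • c + w)) +
      (c i ^ 2 - postAvg C p s (fun d => d i ^ 2) (s • c + w)) * -s) (stdGauss ι) :=
  (integrable_sub_postAvg_mul hp s (fun d => d i) c
    (g := fun y => y i + s * postAvg C p s (fun d => d i) y)
    (integrable_eval_add_mul_postAvg hp s i c)).add
  (integrable_sub_postAvg_mul hp s (fun d => d i ^ 2) c (g := fun _ => -s) (integrable_const _))

lemma integrable_infoDensityDeriv :
    Integrable (fun w => infoDensityDeriv C p s i c (s • c + w)) (stdGauss ι) := by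
  simp only [infoDensityDeriv_eq]
  exact ((integrable_sq_sub_postAvg_add hp s (fun d => d i) c).const_mul s).add
    (integrable_orthogonalTerms hp s i c)

end Integrability

-- The estimation errors of `X i` and of `(X i)²` are orthogonal to every function of the output.
lemma channelExp_infoDensityDeriv (hp : IsProbWeights C p) (s : ℝ) (i : ι) :
    channelExp C p s (infoDensityDeriv C p s i) = s * channelMMSE C p s i := by
  have hsplit : infoDensityDeriv C p s i = fun c y => _ :=
    funext₂ fun c y => infoDensityDeriv_eq s i c y
  rw [hsplit,
    channelExp_add (fun c _ => (integrable_sq_sub_postAvg_add hp s (fun d => d i) c).const_mul s)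
      (fun c _ => integrable_orthogonalTerms hp s i c),
    channelExp_add (fun c _ => integrable_sub_postAvg_mul hp s (fun d => d i) c
        (g := fun y => y i + s * postAvg C p s (fun d => d i) y)
        (integrable_eval_add_mul_postAvg hp s i c))
      (fun c _ => integrable_sub_postAvg_mul hp s (fun d => d i ^ 2) c (g := fun _ => -s)
        (integrable_const _)),
    channelExp_sub_postAvg_mul hp s (fun d => d i)
      (g := fun y => y i + s * postAvg C p s (fun d => d i) y)
      (fun c _ => integrable_eval_add_mul_postAvg hp s i c),
    channelExp_sub_postAvg_mul hp s (fun d => d i ^ 2) (g := fun _ => -s)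
      (fun c _ => integrable_const _), add_zero, add_zero]
  simp only [channelMMSE, channelExp, integral_const_mul, Finset.mul_sum, mul_left_comm s]

lemma abs_sum_infoDensityDeriv_le (hp : IsProbWeights C p) (s : ℝ) (c w : ι → ℝ) :
    |∑ i, infoDensityDeriv C p s i c (s • c + w)| ≤
      ∑ d ∈ C, (|(d - c) ⬝ᵥ w| + |s| * ((d - c) ⬝ᵥ (d - c))) := by
  rw [← neg_postAvg_eq_sum_infoDensityDeriv hp, abs_neg]
  refine (abs_postAvg_le hp s _ _).trans (Finset.sum_le_sum fun d _ => ?_)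
  refine (abs_sub _ _).trans_eq ?_
  rw [abs_mul, abs_of_nonneg (dotProduct_self_nonneg (d - c))]

lemma hasDerivAt_integral_infoDensity (hp : IsProbWeights C p) {c : ι → ℝ} (hc : c ∈ C)
    (hpc : 0 < p c) (s : ℝ) :
    HasDerivAt (fun s => ∫ w, infoDensity C p s c (s • c + w) ∂stdGauss ι)
      (∫ w, ∑ i, infoDensityDeriv C p s i c (s • c + w) ∂stdGauss ι) s := by
  have hdot : ∀ a : ι → ℝ, Integrable (fun w => a ⬝ᵥ w) (stdGauss ι) := fun a =>
    integrable_finsetSum _ fun i _ => ((memLp_eval_stdGauss i).integrable one_le_two).const_mul _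
  refine (hasDerivAt_integral_of_dominated_loc_of_deriv_le (Metric.ball_mem_nhds s one_pos)
    (F' := fun s w => ∑ i, infoDensityDeriv C p s i c (s • c + w))
    (bound := fun w => ∑ d ∈ C, (|(d - c) ⬝ᵥ w| + (|s| + 1) * ((d - c) ⬝ᵥ (d - c))))
    (Eventually.of_forall fun s => (measurable_infoDensity_add s c).aestronglyMeasurable)
    (integrable_infoDensity_add hp hc hpc s)
    (integrable_finsetSum _ fun i _ => integrable_infoDensityDeriv hp s i c).aestronglyMeasurable
    (ae_of_all _ fun w r hr => ?_)
    (integrable_finsetSum _ fun d _ => (hdot (d - c)).abs.add (integrable_const _))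
    (ae_of_all _ fun w r _ => ?_)).2
  · have hrs : |r| ≤ |s| + 1 := by
      have := abs_sub_abs_le_abs_sub r s
      have : |r - s| < 1 := by simpa [Real.dist_eq] using hr
      linarith
    refine (abs_sum_infoDensityDeriv_le hp r c w).trans (Finset.sum_le_sum fun d _ => ?_)
    gcongr
    exact dotProduct_self_nonneg (d - c)
  · rw [← neg_postAvg_eq_sum_infoDensityDeriv hp]
    exact hasDerivAt_infoDensity hp c w r

lemma hasDerivAt_mutualInfo (hp : IsProbWeights C p) (s : ℝ) :
    HasDerivAt (mutualInfo C p) (s * ∑ i, channelMMSE C p s i) s := by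
  have hderiv : ∀ c ∈ C, HasDerivAt
      (fun s => p c * ∫ w, infoDensity C p s c (s • c + w) ∂stdGauss ι)
      (p c * ∫ w, ∑ i, infoDensityDeriv C p s i c (s • c + w) ∂stdGauss ι) s := by
    intro c hc
    rcases (hp.nonneg c hc).eq_or_lt with hpc | hpc
    · simpa only [← hpc, zero_mul] using hasDerivAt_const s (0 : ℝ)
    · exact (hasDerivAt_integral_infoDensity hp hc hpc s).const_mul _
  refine (HasDerivAt.fun_sum hderiv).congr_deriv ?_
  calc channelExp C p s (fun c y => ∑ i, infoDensityDeriv C p s i c y)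
      = ∑ i, channelExp C p s (infoDensityDeriv C p s i) :=
        channelExp_finsetSum _ fun i _ c _ => integrable_infoDensityDeriv hp s i c
    _ = s * ∑ i, channelMMSE C p s i := by
        simp only [channelExp_infoDensityDeriv hp, Finset.mul_sum]

lemma mutualInfo_zero (hp : IsProbWeights C p) : mutualInfo C p 0 = 0 := by
  simp [mutualInfo, channelExp, infoDensity, bayesWeight, hp.sum_eq_one]

lemma tendsto_mutualInfo_atTop (hp : IsProbWeights C p) :
    Tendsto (mutualInfo C p) atTop (𝓝 (∑ c ∈ C, Real.negMulLog (p c))) := by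
  refine tendsto_finsetSum _ fun c hc => ?_
  rcases (hp.nonneg c hc).eq_or_lt with hpc | hpc
  · simp [← hpc]
  · have hlim : Tendsto (fun s => ∫ w, infoDensity C p s c (s • c + w) ∂stdGauss ι) atTop
        (𝓝 (∫ _, -Real.log (p c) ∂stdGauss ι)) :=
      tendsto_integral_filter_of_dominated_convergence (fun w => w ⬝ᵥ w / 2 + |Real.log (p c)|)
        (Eventually.of_forall fun s => (measurable_infoDensity_add s c).aestronglyMeasurable)
        (Eventually.of_forall fun s => ae_of_all _ fun w => abs_infoDensity_add_le hp hc hpc s w)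
        (integrable_dotProduct_self_add_const _)
        (ae_of_all _ fun w => tendsto_infoDensity_add hpc hc w)
    simpa [Real.negMulLog] using hlim.const_mul (p c)

lemma hasDerivAt_mutualInfo_sqrt (hp : IsProbWeights C p) {γ : ℝ} (hγ : 0 < γ) :
    HasDerivAt (fun γ => mutualInfo C p √γ) (2⁻¹ * ∑ i, channelMMSE C p √γ i) γ := by
  refine ((hasDerivAt_mutualInfo hp √γ).comp γ (Real.hasDerivAt_sqrt hγ.ne')).congr_deriv ?_
  have := (Real.sqrt_pos.2 hγ).ne'
  field_simp

lemma lintegral_sum_channelMMSE (hp : IsProbWeights C p) :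
    ∫⁻ γ in Ioi (0 : ℝ), ENNReal.ofReal (∑ i, channelMMSE C p √γ i) =
      ENNReal.ofReal (2 * ∑ c ∈ C, Real.negMulLog (p c)) := by
  have hnonneg : ∀ γ : ℝ, 0 ≤ ∑ i, channelMMSE C p √γ i := fun γ =>
    Finset.sum_nonneg fun i _ => channelMMSE_nonneg hp _ i
  have hcont : ContinuousWithinAt (fun γ => mutualInfo C p √γ) (Ici 0) 0 :=
    ((hasDerivAt_mutualInfo hp √0).continuousAt.comp
      Real.continuous_sqrt.continuousAt).continuousWithinAt
  have hderiv : ∀ γ ∈ Ioi (0 : ℝ), HasDerivAt (fun γ => mutualInfo C p √γ)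
      (2⁻¹ * ∑ i, channelMMSE C p √γ i) γ := fun γ hγ => hasDerivAt_mutualInfo_sqrt hp hγ
  have hderiv_nonneg : ∀ γ ∈ Ioi (0 : ℝ), 0 ≤ 2⁻¹ * ∑ i, channelMMSE C p √γ i := fun γ _ =>
    mul_nonneg (by norm_num) (hnonneg γ)
  have hlim := (tendsto_mutualInfo_atTop hp).comp Real.tendsto_sqrt_atTop
  have hint := integrableOn_Ioi_deriv_of_nonneg hcont hderiv hderiv_nonneg hlim
  have heq := integral_Ioi_of_hasDerivAt_of_nonneg hcont hderiv hderiv_nonneg hlim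
  rw [integral_const_mul, Real.sqrt_zero, mutualInfo_zero hp, sub_zero] at heq
  rw [← ofReal_integral_eq_lintegral_ofReal
    ((integrable_const_mul_iff (Ne.isUnit (by norm_num)) _).1 hint) (ae_of_all _ hnonneg), ← heq,
    mul_inv_cancel_left₀ two_ne_zero]

end MutualInformationDerivative

section JointDensity

variable {Ω α α' β G : Type*} [MeasurableSpace Ω] [MeasurableSpace α] [MeasurableSpace α']
  [MeasurableSpace β] [MeasurableSpace G]

/-- The pair `(X, V)` has joint density `f c v` relative to the product of counting measure on the
finite set `C` and the measure `ν`. -/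
structure HasJointDensity (μ : Measure Ω) (C : Finset α) (X : Ω → α) (V : Ω → β) (ν : Measure β)
    (f : α → β → ℝ) : Prop where
  measurable_input : Measurable X
  measurable_output : Measurable V
  mem : ∀ᵐ ω ∂μ, X ω ∈ C
  nonneg : ∀ c v, 0 ≤ f c v
  measurable : ∀ c, Measurable (f c)
  map_restrict : ∀ c ∈ C,
    (μ.restrict (X ⁻¹' {c})).map V = ν.withDensity fun v => ENNReal.ofReal (f c v)

variable {μ : Measure Ω} {C : Finset α} {X : Ω → α} {V : Ω → β} {ν : Measure β} {f : α → β → ℝ}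

lemma sum_restrict_preimage_singleton [MeasurableSingletonClass α] (hX : Measurable X)
    (hXC : ∀ᵐ ω ∂μ, X ω ∈ C) : ∑ c ∈ C, μ.restrict (X ⁻¹' {c}) = μ := by
  ext s hs
  rw [Measure.finsetSum_apply]
  have hcover : μ s = μ (⋃ c ∈ C, s ∩ X ⁻¹' {c}) := by
    refine measure_congr ?_
    filter_upwards [hXC] with ω hω
    refine propext ⟨fun h => mem_iUnion₂.2 ⟨X ω, hω, h, rfl⟩, fun h => ?_⟩
    obtain ⟨c, -, h, -⟩ := mem_iUnion₂.1 h
    exact h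
  rw [hcover, measure_biUnion_finset]
  · exact Finset.sum_congr rfl fun c _ => Measure.restrict_apply hs
  · refine fun c _ d _ hcd => Set.disjoint_left.2 fun ω hc hd => hcd ?_
    exact hc.2.symm.trans hd.2
  · exact fun c _ => hs.inter (hX (measurableSet_singleton c))

lemma lintegral_eq_sum_setLIntegral_preimage [MeasurableSingletonClass α] (hX : Measurable X)
    (hXC : ∀ᵐ ω ∂μ, X ω ∈ C) (F : Ω → ℝ≥0∞) :
    ∫⁻ ω, F ω ∂μ = ∑ c ∈ C, ∫⁻ ω in X ⁻¹' {c}, F ω ∂μ := by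
  rw [← lintegral_finsetSum_measure, sum_restrict_preimage_singleton hX hXC]

lemma map_restrict_prodMk_of_indepFun [MeasurableSingletonClass α] [IsFiniteMeasure μ]
    (hV : Measurable V) {N : Ω → G} (hN : Measurable N)
    (hindep : IndepFun N (fun ω => (X ω, V ω)) μ) (c : α) :
    (μ.restrict (X ⁻¹' {c})).map (fun ω => (V ω, N ω)) =
      ((μ.restrict (X ⁻¹' {c})).map V).prod (μ.map N) := by
  refine (Measure.prod_eq fun s t hs ht => ?_).symm
  have hprod := hindep.measure_inter_preimage_eq_mul t ({c} ×ˢ s) ht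
    ((measurableSet_singleton c).prod hs)
  rw [Measure.map_apply (hV.prodMk hN) (hs.prod ht), Measure.map_apply hV hs,
    Measure.restrict_apply (hV.prodMk hN (hs.prod ht)), Measure.restrict_apply (hV hs),
    Measure.map_apply hN ht]
  have hrect : (fun ω => (V ω, N ω)) ⁻¹' s ×ˢ t ∩ X ⁻¹' {c} =
      N ⁻¹' t ∩ (fun ω => (X ω, V ω)) ⁻¹' ({c} ×ˢ s) := by
    ext ω
    simp only [mem_inter_iff, mem_preimage, mem_prod]
    tauto
  rw [hrect, hprod, mul_comm, inter_comm]
  rfl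

namespace HasJointDensity

lemma lintegral_eq [MeasurableSingletonClass α] (h : HasJointDensity μ C X V ν f)
    {F : α → β → ℝ≥0∞} (hF : ∀ c, Measurable (F c)) :
    ∫⁻ ω, F (X ω) (V ω) ∂μ = ∑ c ∈ C, ∫⁻ v, ENNReal.ofReal (f c v) * F c v ∂ν := by
  rw [lintegral_eq_sum_setLIntegral_preimage h.measurable_input h.mem]
  refine Finset.sum_congr rfl fun c hc => ?_
  calc ∫⁻ ω in X ⁻¹' {c}, F (X ω) (V ω) ∂μ = ∫⁻ ω in X ⁻¹' {c}, F c (V ω) ∂μ :=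
        setLIntegral_congr_fun (h.measurable_input (measurableSet_singleton c)) fun ω hω => by
          rw [mem_singleton_iff.1 hω]
    _ = ∫⁻ v, ENNReal.ofReal (f c v) * F c v ∂ν := by
        rw [← lintegral_map (hF c) h.measurable_output, h.map_restrict c hc,
          lintegral_withDensity_eq_lintegral_mul _ (h.measurable c).ennreal_ofReal (hF c)]
        rfl

lemma integral_eq [MeasurableSingletonClass α] (h : HasJointDensity μ C X V ν f) {F : α → β → ℝ}
    (hFm : ∀ c, Measurable (F c)) (hF : Integrable (fun ω => F (X ω) (V ω)) μ) :
    ∫ ω, F (X ω) (V ω) ∂μ = ∫ v, ∑ c ∈ C, f c v * F c v ∂ν := by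
  have hcongr : ∀ c, EqOn (fun ω => F (X ω) (V ω)) (fun ω => F c (V ω)) (X ⁻¹' {c}) :=
    fun c ω hω => by simp only [mem_singleton_iff.1 hω]
  have hset : ∀ c, MeasurableSet (X ⁻¹' {c}) := fun c =>
    h.measurable_input (measurableSet_singleton c)
  have hfc : ∀ c, Measurable fun v => ENNReal.ofReal (f c v) := fun c =>
    (h.measurable c).ennreal_ofReal
  have htop : ∀ c, ∀ᵐ v ∂ν, ENNReal.ofReal (f c v) < ⊤ := fun c => ae_of_all _ fun v => by simp
  have hint : ∀ c ∈ C, Integrable (fun v => f c v * F c v) ν := fun c hc => by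
    have hmap : Integrable (F c) ((μ.restrict (X ⁻¹' {c})).map V) :=
      (integrable_map_measure (hFm c).aestronglyMeasurable h.measurable_output.aemeasurable).2
        (hF.integrableOn.congr_fun (hcongr c) (hset c))
    rw [h.map_restrict c hc, integrable_withDensity_iff_integrable_smul' (hfc c) (htop c)] at hmap
    simpa only [ENNReal.toReal_ofReal (h.nonneg c _), smul_eq_mul] using hmap
  rw [integral_finsetSum _ hint]
  conv_lhs => rw [← sum_restrict_preimage_singleton h.measurable_input h.mem]
  rw [integral_finsetSum_measure fun c _ => hF.restrict]
  refine Finset.sum_congr rfl fun c hc => ?_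
  rw [setIntegral_congr_fun (hset c) (hcongr c),
    ← integral_map h.measurable_output.aemeasurable (hFm c).aestronglyMeasurable,
    h.map_restrict c hc, integral_withDensity_eq_integral_toReal_smul (hfc c) (htop c)]
  simp only [ENNReal.toReal_ofReal (h.nonneg c _), smul_eq_mul]

lemma condExp_ae_eq [MeasurableSingletonClass α] [IsFiniteMeasure μ]
    (h : HasJointDensity μ C X V ν f) {g : α → ℝ} (hg : Measurable g) :
    μ[fun ω => g (X ω) | MeasurableSpace.comap V inferInstance] =ᵐ[μ]
      fun ω => C.centerMass (fun c => f c (V ω)) g := by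
  have hV := h.measurable_output
  have hcm : Measurable fun v => C.centerMass (fun c => f c v) g :=
    measurable_centerMass (fun c _ => h.measurable c) g
  have hgint : Integrable (fun ω => g (X ω)) μ := by
    refine Integrable.of_bound (C := ∑ c ∈ C, |g c|)
      (hg.comp h.measurable_input).aestronglyMeasurable ?_
    filter_upwards [h.mem] with ω hω
    exact Finset.single_le_sum (f := fun c => |g c|) (fun c _ => abs_nonneg (g c)) hω
  have hcmint : Integrable (fun ω => C.centerMass (fun c => f c (V ω)) g) μ :=
    Integrable.of_bound (hcm.comp hV).aestronglyMeasurable (∑ c ∈ C, |g c|)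
      (ae_of_all _ fun ω => abs_centerMass_le (fun c _ => h.nonneg c _) g)
  refine (ae_eq_condExp_of_forall_setIntegral_eq hV.comap_le hgint
    (fun _ _ _ => hcmint.integrableOn) ?_
    (hcm.comp (comap_measurable V)).aestronglyMeasurable).symm
  rintro _ ⟨D, hD, rfl⟩ -
  refine (sub_eq_zero.1 ?_).symm
  rw [← integral_sub hgint.integrableOn hcmint.integrableOn, ← integral_indicator (hV hD)]
  have hresidual := h.integral_eq
    (F := fun c => D.indicator fun v => g c - C.centerMass (fun d => f d v) g)
    (fun c => (measurable_const.sub hcm).indicator hD) ((hgint.sub hcmint).indicator (hV hD))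
  refine hresidual.trans (integral_eq_zero_of_ae (ae_of_all _ fun v => ?_))
  by_cases hv : v ∈ D
  · simp only [indicator_of_mem hv]
    exact sum_mul_sub_centerMass (fun c _ => h.nonneg c v) g
  · simp only [indicator_of_notMem hv, mul_zero, Finset.sum_const_zero, Pi.zero_apply]

lemma ae_isProbWeights [MeasurableSingletonClass α] [IsFiniteMeasure μ]
    (h : HasJointDensity μ C X V (μ.map V) f) :
    ∀ᵐ v ∂μ.map V, IsProbWeights C fun c => f c v := by
  have hfm : Measurable fun v => ∑ c ∈ C, ENNReal.ofReal (f c v) :=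
    Finset.measurable_sum _ fun c _ => (h.measurable c).ennreal_ofReal
  have hdensity : (μ.map V).withDensity (fun v => ∑ c ∈ C, ENNReal.ofReal (f c v)) =
      (μ.map V).withDensity 1 := by
    ext D hD
    have hindicator := h.lintegral_eq (F := fun _ => D.indicator 1)
      fun _ => measurable_one.indicator hD
    rw [withDensity_one, withDensity_apply _ hD, ← lintegral_indicator hD,
      ← lintegral_indicator_one hD, lintegral_map (measurable_one.indicator hD)
        h.measurable_output, hindicator,
      ← lintegral_finsetSum (f := fun c v => ENNReal.ofReal (f c v) * D.indicator 1 v) _ fun c _ =>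
        (h.measurable c).ennreal_ofReal.mul (measurable_one.indicator hD)]
    congr with v
    rw [← Finset.sum_mul]
    by_cases hv : v ∈ D <;> simp [hv]
  have hsum := (withDensity_eq_iff_of_sigmaFinite hfm.aemeasurable aemeasurable_const).1 hdensity
  filter_upwards [hsum] with v hv
  refine ⟨fun c _ => h.nonneg c v, ?_⟩
  rw [← ENNReal.ofReal_sum_of_nonneg fun c _ => h.nonneg c v] at hv
  simpa using hv

lemma comp [MeasurableSingletonClass α] [MeasurableSingletonClass α'] [DecidableEq α']
    (h : HasJointDensity μ C X V ν f) {g : α → α'} (hg : Measurable g) {C' : Finset α'}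
    (hC' : ∀ c ∈ C, g c ∈ C') :
    HasJointDensity μ C' (fun ω => g (X ω)) V ν (fun x v => ∑ c ∈ C with g c = x, f c v) where
  measurable_input := hg.comp h.measurable_input
  measurable_output := h.measurable_output
  mem := h.mem.mono fun ω => hC' (X ω)
  nonneg x v := Finset.sum_nonneg fun c _ => h.nonneg c v
  measurable x := Finset.measurable_sum _ fun c _ => h.measurable c
  map_restrict x _ := by
    have hpre : MeasurableSet ((fun ω => g (X ω)) ⁻¹' {x}) :=
      hg.comp h.measurable_input (measurableSet_singleton x)
    ext D hD
    have hindicator := h.lintegral_eq (F := fun c v => if g c = x then D.indicator 1 v else 0)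
      fun c => by split_ifs; exacts [measurable_one.indicator hD, measurable_const]
    rw [Measure.map_apply h.measurable_output hD, Measure.restrict_apply
      (h.measurable_output hD), withDensity_apply _ hD, ← lintegral_indicator_one
      ((h.measurable_output hD).inter hpre)]
    calc ∫⁻ ω, (V ⁻¹' D ∩ (fun ω => g (X ω)) ⁻¹' {x}).indicator 1 ω ∂μ
        = ∫⁻ ω, (if g (X ω) = x then D.indicator 1 (V ω) else 0) ∂μ := by
          refine lintegral_congr fun ω => ?_
          by_cases hx : g (X ω) = x <;> by_cases hω : V ω ∈ D <;> simp [indicator, hx, hω]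
      _ = ∑ c ∈ C with g c = x, ∫⁻ v in D, ENNReal.ofReal (f c v) ∂ν := by
          rw [hindicator, Finset.sum_filter]
          refine Finset.sum_congr rfl fun c _ => ?_
          split_ifs
          · rw [← lintegral_indicator hD]
            congr with v
            by_cases hv : v ∈ D <;> simp [hv]
          · simp
      _ = ∫⁻ v in D, ENNReal.ofReal (∑ c ∈ C with g c = x, f c v) ∂ν := by
          rw [← lintegral_finsetSum _ fun c _ => (h.measurable c).ennreal_ofReal]
          simp only [ENNReal.ofReal_sum_of_nonneg fun c _ => h.nonneg c _]

lemma channel [MeasurableSingletonClass α] [IsFiniteMeasure μ] [SFinite ν] [Add G]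
    [MeasurableAdd₂ G] {ρ : Measure G} {N : Ω → G} {a : α → G} {d : α → G → ℝ}
    (h : HasJointDensity μ C X V ν f) (ha : Measurable a) (hN : Measurable N)
    (hNlaw : μ.map N = ρ) (hindep : IndepFun N (fun ω => (X ω, V ω)) μ)
    (hd : ∀ c v, 0 ≤ d c v) (hdm : ∀ c, Measurable (d c))
    (hρ : ∀ c ∈ C, ρ.map (a c + ·) = ρ.withDensity fun w => ENNReal.ofReal (d c w)) :
    HasJointDensity μ C X (fun ω => (V ω, a (X ω) + N ω)) (ν.prod ρ)
      (fun c v => f c v.1 * d c v.2) where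
  measurable_input := h.measurable_input
  measurable_output :=
    h.measurable_output.prodMk ((ha.comp h.measurable_input).add hN)
  mem := h.mem
  nonneg c v := mul_nonneg (h.nonneg c _) (hd c _)
  measurable c := ((h.measurable c).comp measurable_fst).mul ((hdm c).comp measurable_snd)
  map_restrict c hc := by
    have hXc := h.measurable_input (measurableSet_singleton c)
    have hV := h.measurable_output
    have : IsFiniteMeasure ρ := hNlaw ▸ inferInstance
    calc (μ.restrict (X ⁻¹' {c})).map (fun ω => (V ω, a (X ω) + N ω))
        = (μ.restrict (X ⁻¹' {c})).map (fun ω => (V ω, a c + N ω)) :=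
          Measure.map_congr <| (ae_restrict_iff' hXc).2 <| ae_of_all _ fun ω hω => by
            simp only [mem_singleton_iff.1 hω]
      _ = ((μ.restrict (X ⁻¹' {c})).map (fun ω => (V ω, N ω))).map (Prod.map id (a c + ·)) := by
          rw [Measure.map_map (by fun_prop) (hV.prodMk hN)]
          rfl
      _ = (ν.withDensity fun v => ENNReal.ofReal (f c v)).prod
            (ρ.withDensity fun w => ENNReal.ofReal (d c w)) := by
          rw [map_restrict_prodMk_of_indepFun hV hN hindep c, hNlaw,
            ← Measure.map_prod_map _ _ measurable_id (measurable_const_add (a c)),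
            Measure.map_id, h.map_restrict c hc, hρ c hc]
      _ = (ν.prod ρ).withDensity fun v => ENNReal.ofReal (f c v.1 * d c v.2) := by
          rw [prod_withDensity (h.measurable c).ennreal_ofReal (hdm c).ennreal_ofReal]
          simp only [ENNReal.ofReal_mul (h.nonneg c _)]

end HasJointDensity

lemma exists_hasJointDensity [MeasurableSingletonClass α] [IsFiniteMeasure μ] (hX : Measurable X)
    (hV : Measurable V) (hXC : ∀ᵐ ω ∂μ, X ω ∈ C) :
    ∃ q, HasJointDensity μ C X V (μ.map V) q := by
  refine ⟨fun c v => (((μ.restrict (X ⁻¹' {c})).map V).rnDeriv (μ.map V) v).toReal, hX, hV, hXC,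
    fun _ _ => ENNReal.toReal_nonneg, fun c => (Measure.measurable_rnDeriv _ _).ennreal_toReal,
    fun c _ => ?_⟩
  have hac : (μ.restrict (X ⁻¹' {c})).map V ≪ μ.map V :=
    Measure.absolutelyContinuous_of_le (Measure.map_mono Measure.restrict_le_self hV)
  conv_lhs => rw [← Measure.withDensity_rnDeriv_eq _ _ hac]
  refine withDensity_congr_ae ?_
  filter_upwards [Measure.rnDeriv_lt_top ((μ.restrict (X ⁻¹' {c})).map V) (μ.map V)] with v hv
  rw [ENNReal.ofReal_toReal hv.ne]

lemma HasJointDensity.condProb_ae_eq [MeasurableSingletonClass α] [IsFiniteMeasure μ]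
    (h : HasJointDensity μ C X V (μ.map V) f) {c : α} (hc : c ∈ C) :
    μ⟦X ⁻¹' {c} | MeasurableSpace.comap V inferInstance⟧ =ᵐ[μ] fun ω => f c (V ω) := by
  classical
  refine (h.condExp_ae_eq (g := ({c} : Set α).indicator fun _ => 1)
    (measurable_const.indicator (measurableSet_singleton c))).trans ?_
  filter_upwards [ae_of_ae_map h.measurable_output.aemeasurable h.ae_isProbWeights] with ω hω
  rw [Finset.centerMass, hω.sum_eq_one, inv_one, one_smul]
  simp [indicator, hc]

end JointDensity

section Entropy

variable {Ω α β : Type*} [MeasurableSpace Ω] [MeasurableSpace β] {μ : Measure Ω}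

lemma IsProbWeights.negMulLog_nonneg {t : Finset α} {p : α → ℝ} (hp : IsProbWeights t p) {a : α}
    (ha : a ∈ t) : 0 ≤ Real.negMulLog (p a) :=
  Real.negMulLog_nonneg (hp.nonneg a ha) (hp.sum_eq_one ▸ Finset.single_le_sum hp.nonneg ha)

lemma IsProbWeights.abs_sum_negMulLog_le {t : Finset α} {p : α → ℝ} (hp : IsProbWeights t p) :
    |∑ a ∈ t, Real.negMulLog (p a)| ≤ t.card := by
  rw [abs_of_nonneg (Finset.sum_nonneg fun a => hp.negMulLog_nonneg), ← nsmul_one,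
    ← Finset.sum_const]
  refine Finset.sum_le_sum fun a ha => ?_
  linarith [Real.negMulLog_le_one_sub_self (hp.nonneg a ha), hp.nonneg a ha]

lemma HasJointDensity.lintegral_sum_negMulLog [MeasurableSpace α] [MeasurableSingletonClass α]
    [IsFiniteMeasure μ] {C : Finset α} {X : Ω → α} {V : Ω → β} {q : α → β → ℝ}
    (h : HasJointDensity μ C X V (μ.map V) q) :
    ∫⁻ v, ENNReal.ofReal (∑ c ∈ C, Real.negMulLog (q c v)) ∂μ.map V =
      ENNReal.ofReal (∫ ω, ∑ c ∈ C,
        Real.negMulLog ((μ⟦X ⁻¹' {c} | MeasurableSpace.comap V inferInstance⟧) ω) ∂μ) := by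
  have hV := h.measurable_output
  have hmeas : Measurable fun v => ∑ c ∈ C, Real.negMulLog (q c v) :=
    Finset.measurable_sum _ fun c _ => Real.continuous_negMulLog.measurable.comp (h.measurable c)
  have hweights := ae_of_ae_map hV.aemeasurable h.ae_isProbWeights
  have hint : Integrable (fun ω => ∑ c ∈ C, Real.negMulLog (q c (V ω))) μ :=
    Integrable.of_bound (hmeas.comp hV).aestronglyMeasurable (C.card : ℝ)
      (hweights.mono fun ω hω => hω.abs_sum_negMulLog_le)
  have hcond := (Filter.eventually_all_finset C).2 fun c hc => h.condProb_ae_eq hc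
  rw [lintegral_map hmeas.ennreal_ofReal hV, ← ofReal_integral_eq_lintegral_ofReal hint
    (hweights.mono fun ω hω => Finset.sum_nonneg fun c => hω.negMulLog_nonneg)]
  congr 1
  refine integral_congr_ae ?_
  filter_upwards [hcond] with ω hω
  exact Finset.sum_congr rfl fun c hc => by rw [hω c hc]

end Entropy

section ConditionalMutualInformation

variable {Ω α β ι : Type*} [MeasurableSpace Ω] [MeasurableSpace α] [MeasurableSpace β] [Fintype ι]
  {μ : Measure Ω} [IsProbabilityMeasure μ]

lemma HasJointDensity.ofReal_mmse [MeasurableSingletonClass α] {C : Finset α} {X : Ω → α}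
    {V : Ω → β} {ν : Measure β} {f : α → β → ℝ} (h : HasJointDensity μ C X V ν f) {g : α → ℝ}
    (hg : Measurable g) :
    ENNReal.ofReal (mmse μ (fun ω => g (X ω)) V) =
      ∑ c ∈ C, ∫⁻ v, ENNReal.ofReal (f c v) *
        ENNReal.ofReal ((g c - C.centerMass (fun d => f d v) g) ^ 2) ∂ν := by
  have hmeas : ∀ c, Measurable fun v => (g c - C.centerMass (fun d => f d v) g) ^ 2 := fun c =>
    (measurable_const.sub (measurable_centerMass (fun d _ => h.measurable d) g)).pow_const 2
  have herror : mmse μ (fun ω => g (X ω)) V =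
      ∫ ω, (g (X ω) - C.centerMass (fun d => f d (V ω)) g) ^ 2 ∂μ :=
    integral_congr_ae <| (h.condExp_ae_eq hg).mono fun ω hω => by simp only [hω]
  have hint : Integrable (fun ω => (g (X ω) - C.centerMass (fun d => f d (V ω)) g) ^ 2) μ := by
    refine Integrable.of_bound (C := (∑ c ∈ C, |g c| + ∑ c ∈ C, |g c|) ^ 2) ?_ ?_
    · exact (((hg.comp h.measurable_input).sub ((measurable_centerMass
        (fun d _ => h.measurable d) g).comp h.measurable_output)).pow_const 2).aestronglyMeasurable
    · filter_upwards [h.mem] with ω hω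
      rw [Real.norm_eq_abs, abs_pow]
      refine pow_le_pow_left₀ (abs_nonneg _) ((abs_sub _ _).trans (add_le_add ?_ ?_)) 2
      · exact Finset.single_le_sum (f := fun c => |g c|) (fun c _ => abs_nonneg (g c)) hω
      · exact abs_centerMass_le (fun d _ => h.nonneg d _) g
  rw [herror, ofReal_integral_eq_lintegral_ofReal hint (ae_of_all _ fun _ => sq_nonneg _)]
  exact h.lintegral_eq fun c => (hmeas c).ennreal_ofReal

lemma measurable_channelMMSE {C : Finset (ι → ℝ)} {q : (ι → ℝ) → β → ℝ}
    (hq : ∀ c, Measurable (q c)) (i : ι) :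
    Measurable fun x : ℝ × β => channelMMSE C (fun c => q c x.2) x.1 i := by
  unfold channelMMSE channelExp
  refine Finset.measurable_sum _ fun c _ => ((hq c).comp measurable_snd).mul ?_
  have herror : Measurable fun x : (ℝ × β) × (ι → ℝ) =>
      (c i - postAvg C (fun c => q c x.1.2) x.1.1 (fun d => d i) (x.1.1 • c + x.2)) ^ 2 := by
    refine (measurable_const.sub (measurable_centerMass (fun d _ => ?_) _)).pow_const 2
    unfold bayesWeight
    exact ((hq d).comp (measurable_snd.comp measurable_fst)).mul (by fun_prop)
  exact herror.stronglyMeasurable.integral_prod_right'.measurable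

lemma HasJointDensity.gaussianChannel {C : Finset α} [MeasurableSingletonClass α] {X : Ω → α}
    {V : Ω → β} {ν : Measure β} [SFinite ν] {f : α → β → ℝ} {N : Ω → ι → ℝ} {a : α → ι → ℝ}
    (h : HasJointDensity μ C X V ν f) (ha : Measurable a) (hN : Measurable N)
    (hNlaw : μ.map N = stdGauss ι) (hindep : IndepFun N (fun ω => (X ω, V ω)) μ) (s : ℝ) :
    HasJointDensity μ C X (fun ω => (V ω, s • a (X ω) + N ω)) (ν.prod (stdGauss ι))
      (fun c v => f c v.1 * shiftDensity (s • a c) v.2) :=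
  h.channel (a := fun c => s • a c) (ha.const_smul s) hN hNlaw hindep
    (fun _ _ => (shiftDensity_pos _ _).le) (fun _ => by fun_prop) fun _ _ => stdGauss_map_add _

variable {C : Finset (ι → ℝ)} {X N : Ω → ι → ℝ} {Z : Ω → β}

lemma ofReal_channelMMSE {p : (ι → ℝ) → ℝ} (hp : IsProbWeights C p) (s : ℝ) (i : ι) :
    ENNReal.ofReal (channelMMSE C p s i) = ∑ c ∈ C, ∫⁻ y, ENNReal.ofReal (bayesWeight p s y c) *
      ENNReal.ofReal ((c i - postAvg C p s (fun d => d i) y) ^ 2) ∂stdGauss ι := by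
  rw [channelMMSE, channelExp, ENNReal.ofReal_sum_of_nonneg fun c hc =>
    mul_nonneg (hp.nonneg c hc) (integral_nonneg fun _ => sq_nonneg _)]
  refine Finset.sum_congr rfl fun c hc => ?_
  have hmeas : Measurable fun y =>
      ENNReal.ofReal ((c i - postAvg C p s (fun d => d i) y) ^ 2) :=
    ((measurable_const.sub (measurable_postAvg s _)).pow_const 2).ennreal_ofReal
  rw [ENNReal.ofReal_mul (hp.nonneg c hc), ofReal_integral_eq_lintegral_ofReal
      (integrable_sq_sub_postAvg_add hp s (fun d => d i) c) (ae_of_all _ fun _ => sq_nonneg _),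
    lintegral_stdGauss_add (s • c) hmeas, ← lintegral_const_mul _ (by fun_prop)]
  simp only [bayesWeight, ENNReal.ofReal_mul (hp.nonneg c hc), mul_assoc]

lemma HasJointDensity.ofReal_mmse_gaussianChannel {q : (ι → ℝ) → β → ℝ}
    (h : HasJointDensity μ C X Z (μ.map Z) q) (hN : Measurable N)
    (hNlaw : μ.map N = stdGauss ι) (hindep : IndepFun N (fun ω => (X ω, Z ω)) μ) (s : ℝ) (i : ι) :
    ENNReal.ofReal (mmse μ (fun ω => X ω i) (fun ω => (Z ω, s • X ω + N ω))) =
      ∫⁻ z, ENNReal.ofReal (channelMMSE C (fun c => q c z) s i) ∂μ.map Z := by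
  have hchannel := h.gaussianChannel measurable_id hN hNlaw hindep s
  have hmeas : ∀ c, Measurable fun v : β × (ι → ℝ) =>
      ENNReal.ofReal (q c v.1 * shiftDensity (s • c) v.2) *
        ENNReal.ofReal ((c i - postAvg C (fun c => q c v.1) s (fun d => d i) v.2) ^ 2) := fun c =>
    (hchannel.measurable c).ennreal_ofReal.mul ((measurable_const.sub
      (measurable_centerMass (fun d _ => hchannel.measurable d) _)).pow_const 2).ennreal_ofReal
  calc ENNReal.ofReal (mmse μ (fun ω => X ω i) (fun ω => (Z ω, s • X ω + N ω)))
      = ∑ c ∈ C, ∫⁻ v, ENNReal.ofReal (q c v.1 * shiftDensity (s • c) v.2) * ENNReal.ofReal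
          ((c i - postAvg C (fun c => q c v.1) s (fun d => d i) v.2) ^ 2)
          ∂(μ.map Z).prod (stdGauss ι) := hchannel.ofReal_mmse (measurable_pi_apply i)
    _ = ∑ c ∈ C, ∫⁻ z, ∫⁻ y, ENNReal.ofReal (q c z * shiftDensity (s • c) y) * ENNReal.ofReal
          ((c i - postAvg C (fun c => q c z) s (fun d => d i) y) ^ 2) ∂stdGauss ι ∂μ.map Z :=
        Finset.sum_congr rfl fun c _ => lintegral_prod _ (hmeas c).aemeasurable
    _ = ∫⁻ z, ENNReal.ofReal (channelMMSE C (fun c => q c z) s i) ∂μ.map Z := by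
        rw [← lintegral_finsetSum _ fun c _ => (hmeas c).lintegral_prod_right']
        exact lintegral_congr_ae (h.ae_isProbWeights.mono fun z hz =>
          (ofReal_channelMMSE hz s i).symm)

lemma lintegral_sum_mmse_gaussianChannel (hX : Measurable X) (hN : Measurable N)
    (hZ : Measurable Z) (hXC : ∀ᵐ ω ∂μ, X ω ∈ C) (hNlaw : μ.map N = stdGauss ι)
    (hindep : IndepFun N (fun ω => (X ω, Z ω)) μ) :
    ∫⁻ γ in Ioi (0 : ℝ), ∑ i, ENNReal.ofReal
        (mmse μ (fun ω => X ω i) (fun ω => (Z ω, √γ • X ω + N ω))) =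
      2 * ENNReal.ofReal (∫ ω, ∑ c ∈ C,
        Real.negMulLog ((μ⟦X ⁻¹' {c} | MeasurableSpace.comap Z inferInstance⟧) ω) ∂μ) := by
  obtain ⟨q, hq⟩ := exists_hasJointDensity hX hZ hXC
  have hmmse : ∀ γ : ℝ, ∑ i, ENNReal.ofReal
      (mmse μ (fun ω => X ω i) (fun ω => (Z ω, √γ • X ω + N ω))) =
      ∫⁻ z, ENNReal.ofReal (∑ i, channelMMSE C (fun c => q c z) √γ i) ∂μ.map Z := by
    intro γ
    simp only [hq.ofReal_mmse_gaussianChannel hN hNlaw hindep]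
    have hmeas : ∀ i, Measurable fun z => channelMMSE C (fun c => q c z) √γ i := fun i =>
      (measurable_channelMMSE hq.measurable i).comp measurable_prodMk_left
    rw [← lintegral_finsetSum _ fun i _ => (hmeas i).ennreal_ofReal]
    refine lintegral_congr_ae ?_
    filter_upwards [hq.ae_isProbWeights] with z hz
    exact (ENNReal.ofReal_sum_of_nonneg fun i _ => channelMMSE_nonneg hz _ i).symm
  have hmeas : Measurable fun x : ℝ × β =>
      ENNReal.ofReal (∑ i, channelMMSE C (fun c => q c x.2) √x.1 i) :=
    (Finset.measurable_sum _ fun i _ => (measurable_channelMMSE hq.measurable i).comp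
      (g := fun x : ℝ × β => channelMMSE C (fun c => q c x.2) x.1 i)
      (f := fun x : ℝ × β => (√x.1, x.2)) (by fun_prop)).ennreal_ofReal
  have hentropy : Measurable fun z => ∑ c ∈ C, Real.negMulLog (q c z) :=
    Finset.measurable_sum _ fun c _ => Real.continuous_negMulLog.measurable.comp (hq.measurable c)
  simp only [hmmse]
  rw [lintegral_lintegral_swap
      (f := fun γ z => ENNReal.ofReal (∑ i, channelMMSE C (fun c => q c z) √γ i))
      hmeas.aemeasurable,
    lintegral_congr_ae (hq.ae_isProbWeights.mono fun z hz => lintegral_sum_channelMMSE hz),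
    ← hq.lintegral_sum_negMulLog, ← lintegral_const_mul _ hentropy.ennreal_ofReal]
  simp only [ENNReal.ofReal_mul zero_le_two, ENNReal.ofReal_ofNat]

end ConditionalMutualInformation

section BinaryInput

variable {Ω β γ : Type*} [MeasurableSpace Ω] [MeasurableSpace β] [MeasurableSpace γ]
  {μ : Measure Ω}

lemma mmse_comp_of_leftInverse {X : Ω → ℝ} {Y : Ω → β} {g : β → γ} {g' : γ → β}
    (hg : Measurable g) (hg' : Measurable g') (hinv : Function.LeftInverse g' g) :
    mmse μ X (fun ω => g (Y ω)) = mmse μ X Y := by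
  have hcomap : MeasurableSpace.comap (fun ω => g (Y ω)) inferInstance =
      MeasurableSpace.comap Y inferInstance := by
    refine le_antisymm (hg.comp (comap_measurable Y)).comap_le ?_
    have hY : Y = fun ω => g' (g (Y ω)) := funext fun ω => (hinv (Y ω)).symm
    conv_lhs => rw [hY]
    exact (hg'.comp (comap_measurable fun ω => g (Y ω))).comap_le
  rw [mmse, hcomap, mmse]

/-- The mean squared error `4 p q` in estimating a `±1` bit which is `1` with probability `p` and
`-1` with probability `q = 1 - p`, as a function of its log likelihood ratio `log (p / q)`. -/
def softError (l : EReal) : ℝ≥0∞ :=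
  4 / (l.exp + 2 + (-l).exp)

@[fun_prop]
lemma measurable_softError : Measurable softError := by
  unfold softError
  have hneg : Measurable fun l : EReal => (-l).exp := EReal.measurable_exp.comp measurable_neg
  exact measurable_const.div ((EReal.measurable_exp.add_const 2).add hneg)

@[simp]
lemma softError_top : softError ⊤ = 0 := by simp [softError]

@[simp]
lemma softError_bot : softError ⊥ = 0 := by simp [softError]

lemma softError_log_div {p q : ℝ} (hp : 0 ≤ p) (hq : 0 ≤ q) (hpq : p + q = 1) :
    softError (ENNReal.log (ENNReal.ofReal p / ENNReal.ofReal q)) =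
      ENNReal.ofReal (4 * p * q) := by
  rcases hp.eq_or_lt with rfl | hp
  · simp
  rcases hq.eq_or_lt with rfl | hq
  · simp [ENNReal.div_zero, hp]
  rw [softError, ← ENNReal.log_inv, ENNReal.exp_log, ENNReal.exp_log,
    ← ENNReal.ofReal_div_of_pos hq, ← ENNReal.ofReal_inv_of_pos (by positivity),
    ← ENNReal.ofReal_ofNat 2, ← ENNReal.ofReal_ofNat 4,
    ← ENNReal.ofReal_add (by positivity) (by positivity),
    ← ENNReal.ofReal_add (by positivity) (by positivity),
    ← ENNReal.ofReal_div_of_pos (by positivity)]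
  congr 1
  field_simp
  linear_combination (-(p + q + 1)) * hpq

lemma HasJointDensity.ae_sum_pos {α : Type*} [MeasurableSpace α] [MeasurableSingletonClass α]
    {C : Finset α} {X : Ω → α} {V : Ω → β} {ν : Measure β} {f : α → β → ℝ}
    (h : HasJointDensity μ C X V ν f) : ∀ᵐ ω ∂μ, 0 < ∑ c ∈ C, f c (V ω) := by
  have hnull : MeasurableSet {v | ∑ c ∈ C, f c v = 0} :=
    (Finset.measurable_sum _ fun c _ => h.measurable c) (measurableSet_singleton 0)
  have hzero := h.lintegral_eq (F := fun _ => {v | ∑ c ∈ C, f c v = 0}.indicator 1)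
    fun _ => measurable_one.indicator hnull
  rw [Finset.sum_eq_zero, lintegral_eq_zero_iff (f := fun ω => indicator _ 1 (V ω))
    ((measurable_one.indicator hnull).comp h.measurable_output)] at hzero
  · filter_upwards [hzero] with ω hω
    refine (Finset.sum_nonneg fun c _ => h.nonneg c _).lt_of_ne' fun hsum => ?_
    rw [indicator_of_mem (show V ω ∈ {v | ∑ c ∈ C, f c v = 0} from hsum)] at hω
    exact one_ne_zero hω
  · refine fun c hc => lintegral_eq_zero_of_ae_eq_zero (ae_of_all _ fun v => ?_)
    by_cases hv : ∑ c ∈ C, f c v = 0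
    · simp [(Finset.sum_eq_zero_iff_of_nonneg fun c _ => h.nonneg c v).1 hv c hc]
    · simp [hv]

variable {B N : Ω → ℝ} {V : Ω → β} {ν : Measure β} {f : ℝ → β → ℝ}

lemma measurable_log_div (hf : ∀ x, Measurable (f x)) : Measurable fun v =>
    ENNReal.log (ENNReal.ofReal (f 1 v) / ENNReal.ofReal (f (-1) v)) :=
  ENNReal.measurable_log.comp ((hf 1).ennreal_ofReal.div (hf (-1)).ennreal_ofReal)

lemma HasJointDensity.llr_ae_eq [IsFiniteMeasure μ] (h : HasJointDensity μ {1, -1} B V ν f) :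
    _root_.llr μ B V =ᵐ[μ] fun ω =>
      ENNReal.log (ENNReal.ofReal (f 1 (V ω)) / ENNReal.ofReal (f (-1) (V ω))) := by
  have hindicator : ∀ x : ℝ, Measurable (({x} : Set ℝ).indicator fun _ => (1 : ℝ)) := fun x =>
    measurable_const.indicator (measurableSet_singleton x)
  filter_upwards [h.ae_sum_pos, h.condExp_ae_eq (hindicator 1),
    h.condExp_ae_eq (hindicator (-1))] with ω hsum hone hneg
  have hne : (1 : ℝ) ≠ -1 := by norm_num
  rw [Finset.sum_pair hne] at hsum
  simp only [Finset.centerMass, Finset.sum_pair hne, indicator_of_mem (mem_singleton _),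
    indicator_of_notMem (mem_singleton_iff.not.2 hne),
    indicator_of_notMem (mem_singleton_iff.not.2 hne.symm), smul_eq_mul, mul_one, mul_zero,
    add_zero, zero_add] at hone hneg
  have hS := inv_pos.2 hsum
  change ENNReal.log (ENNReal.ofReal ((μ[fun ω => ({1} : Set ℝ).indicator (fun _ => 1) (B ω) | _])
    ω) / ENNReal.ofReal ((μ[fun ω => ({-1} : Set ℝ).indicator (fun _ => 1) (B ω) | _]) ω)) = _
  rw [hone, hneg, ENNReal.ofReal_mul hS.le, ENNReal.ofReal_mul hS.le,
    ENNReal.mul_div_mul_left _ _ (by simpa using hS) ENNReal.ofReal_ne_top]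

variable [IsProbabilityMeasure μ]

lemma ofReal_mmse_eq_lintegral_softError (hB : Measurable B) (hV : Measurable V)
    (hB' : ∀ᵐ ω ∂μ, B ω ∈ ({1, -1} : Finset ℝ)) :
    ENNReal.ofReal (mmse μ B V) = ∫⁻ ω, softError (_root_.llr μ B V ω) ∂μ := by
  obtain ⟨q, hq⟩ := exists_hasJointDensity hB hV hB'
  have hne : (1 : ℝ) ≠ -1 := by norm_num
  have hmeas : ∀ c : ℝ, Measurable fun v => ENNReal.ofReal (q c v) *
      ENNReal.ofReal ((c - ({1, -1} : Finset ℝ).centerMass (fun d => q d v) id) ^ 2) := fun c =>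
    (hq.measurable c).ennreal_ofReal.mul ((measurable_const.sub
      (measurable_centerMass (fun d _ => hq.measurable d) id)).pow_const 2).ennreal_ofReal
  have hllr : ∫⁻ ω, softError (_root_.llr μ B V ω) ∂μ = ∫⁻ v, softError
      (ENNReal.log (ENNReal.ofReal (q 1 v) / ENNReal.ofReal (q (-1) v))) ∂μ.map V := by
    refine Eq.trans ?_ (lintegral_map (measurable_softError.comp
      (measurable_log_div hq.measurable)) hV).symm
    exact lintegral_congr_ae (hq.llr_ae_eq.mono fun ω hω => by simp only [hω, Function.comp_apply])
  have hmmse := hq.ofReal_mmse measurable_id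
  simp only [id] at hmmse hmeas
  rw [hllr, hmmse, ← lintegral_finsetSum _ fun c _ => hmeas c]
  refine lintegral_congr_ae ?_
  filter_upwards [hq.ae_isProbWeights] with v hv
  have hp := hv.nonneg 1 (by simp)
  have hq' := hv.nonneg (-1) (by simp)
  have hsum := hv.sum_eq_one
  rw [Finset.sum_pair hne] at hsum
  rw [softError_log_div hp hq' hsum, Finset.sum_pair hne, ← ENNReal.ofReal_mul hp,
    ← ENNReal.ofReal_mul hq', ← ENNReal.ofReal_add (by positivity) (by positivity)]
  congr 1
  rw [Finset.centerMass, Finset.sum_pair hne, Finset.sum_pair hne, hsum]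
  simp only [inv_one, one_mul, smul_eq_mul, id]
  rw [show q (-1) v = 1 - q 1 v by linarith]
  ring

lemma exists_measurable_llr_ae_eq (hB : Measurable B) (hV : Measurable V)
    (hB' : ∀ᵐ ω ∂μ, B ω ∈ ({1, -1} : Finset ℝ)) :
    ∃ φ : β → EReal, Measurable φ ∧ _root_.llr μ B V =ᵐ[μ] φ ∘ V := by
  obtain ⟨q, hq⟩ := exists_hasJointDensity hB hV hB'
  exact ⟨_, measurable_log_div hq.measurable, hq.llr_ae_eq⟩

lemma llr_gaussianChannel_ae_eq (hB : Measurable B) (hV : Measurable V)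
    (hB' : ∀ᵐ ω ∂μ, B ω ∈ ({1, -1} : Finset ℝ)) (hN : Measurable N)
    (hNlaw : μ.map N = gaussianReal 0 1) (hindep : IndepFun N (fun ω => (B ω, V ω)) μ) (s : ℝ) :
    _root_.llr μ B (fun ω => (V ω, s * B ω + N ω)) =ᵐ[μ] fun ω =>
      _root_.llr μ B V ω + ((2 * s * (s * B ω + N ω) : ℝ) : EReal) := by
  obtain ⟨q, hq⟩ := exists_hasJointDensity hB hV hB'
  have hchannel := hq.channel (a := (s * ·))
    (d := fun c y => Real.exp (s * c * y - s * c * (s * c) / 2)) (by fun_prop) hN hNlaw hindep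
    (fun _ _ => (Real.exp_pos _).le) (fun _ => by fun_prop) fun c _ => by
      rw [gaussianReal_map_const_add, zero_add, gaussianReal_eq_withDensity_exp]
  filter_upwards [hchannel.llr_ae_eq, hq.llr_ae_eq] with ω hout hin
  rw [hout, hin]
  simp only [mul_one]
  set y := s * B ω + N ω
  have hratio : Real.exp (s * y - s * s / 2) =
      Real.exp (s * -1 * y - s * -1 * (s * -1) / 2) * Real.exp (2 * s * y) := by
    rw [← Real.exp_add]
    congr 1
    ring
  rw [hratio, mul_comm (Real.exp _), ← mul_assoc, ENNReal.ofReal_mul' (Real.exp_pos _).le,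
    ENNReal.ofReal_mul (hq.nonneg (-1) _), ENNReal.mul_div_mul_right _ _
      (by simpa using Real.exp_pos _) ENNReal.ofReal_ne_top, ENNReal.ofReal_mul (hq.nonneg _ _),
    ENNReal.mul_div_right_comm, ENNReal.log_mul_add, ENNReal.log_ofReal_of_pos (Real.exp_pos _),
    Real.log_exp]

lemma ofReal_mmse_gaussianChannel (hB : Measurable B) (hV : Measurable V)
    (hB' : ∀ᵐ ω ∂μ, B ω ∈ ({1, -1} : Finset ℝ)) (hN : Measurable N)
    (hNlaw : μ.map N = gaussianReal 0 1) (hindep : IndepFun N (fun ω => (B ω, V ω)) μ) (s : ℝ) :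
    ENNReal.ofReal (mmse μ B (fun ω => (V ω, s * B ω + N ω))) =
      ∑ x ∈ {1, -1}, ∫⁻ w, ∫⁻ l, softError (l + ((2 * s * (s * x + w) : ℝ) : EReal))
        ∂(μ.restrict (B ⁻¹' {x})).map (_root_.llr μ B V) ∂gaussianReal 0 1 := by
  obtain ⟨φ, hφ, hllr⟩ := exists_measurable_llr_ae_eq hB hV hB'
  have hset : ∀ x, MeasurableSet (B ⁻¹' {x}) := fun x => hB (measurableSet_singleton x)
  have hpair : ∀ x : ℝ, Measurable fun p : β × ℝ =>
      softError (φ p.1 + ((2 * s * (s * x + p.2) : ℝ) : EReal)) := fun x =>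
    measurable_softError.comp ((hφ.comp measurable_fst).add (by fun_prop))
  rw [ofReal_mmse_eq_lintegral_softError hB (hV.prodMk (by fun_prop)) hB',
    lintegral_eq_sum_setLIntegral_preimage hB hB']
  refine Finset.sum_congr rfl fun x _ => ?_
  calc ∫⁻ ω in B ⁻¹' {x}, softError (_root_.llr μ B (fun ω => (V ω, s * B ω + N ω)) ω) ∂μ
      = ∫⁻ ω in B ⁻¹' {x}, softError (φ (V ω) + ((2 * s * (s * x + N ω) : ℝ) : EReal)) ∂μ := by
        refine setLIntegral_congr_fun_ae (hset x) ?_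
        filter_upwards [llr_gaussianChannel_ae_eq hB hV hB' hN hNlaw hindep s, hllr]
          with ω hout hin hω
        rw [hout, hin, mem_singleton_iff.1 hω, Function.comp_apply]
    _ = ∫⁻ w, ∫⁻ v, softError (φ v + ((2 * s * (s * x + w) : ℝ) : EReal))
          ∂(μ.restrict (B ⁻¹' {x})).map V ∂gaussianReal 0 1 := by
        rw [← lintegral_prod_symm _ (hpair x).aemeasurable, ← hNlaw,
          ← map_restrict_prodMk_of_indepFun hV hN hindep x, lintegral_map (hpair x) (hV.prodMk hN)]
    _ = ∫⁻ w, ∫⁻ l, softError (l + ((2 * s * (s * x + w) : ℝ) : EReal))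
          ∂(μ.restrict (B ⁻¹' {x})).map (_root_.llr μ B V) ∂gaussianReal 0 1 := by
        refine lintegral_congr fun w => ?_
        rw [Measure.map_congr (ae_restrict_of_ae hllr), ← Measure.map_map hφ hV]
        exact (lintegral_map (measurable_softError.comp (measurable_id.add_const _)) hφ).symm

end BinaryInput

section EquiprobableBit

lemma awgnLLRLaw_coe (γ : ℝ≥0) (x : ℝ) :
    awgnLLRLaw γ x = (gaussianReal (2 * γ * x) (4 * γ)).map Real.toEReal := by
  simp [awgnLLRLaw]

lemma gaussianReal_map_awgnLLR (γ : ℝ≥0) (x : ℝ) :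
    (gaussianReal 0 1).map (fun w => 2 * √γ * (√γ * x + w)) =
      gaussianReal (2 * γ * x) (4 * γ) := by
  have hcomp : (fun w => 2 * √γ * (√γ * x + w)) = (2 * √γ * ·) ∘ (√γ * x + ·) := rfl
  rw [hcomp, ← Measure.map_map (by fun_prop) (by fun_prop), gaussianReal_map_const_add,
    gaussianReal_map_const_mul]
  congr 1
  · linear_combination 2 * x * Real.mul_self_sqrt γ.coe_nonneg
  · ext
    push_cast
    linear_combination 4 * Real.mul_self_sqrt γ.coe_nonneg

lemma lintegral_awgnLLRLaw_add (g : ℝ≥0∞) (γ : ℝ≥0) (x : ℝ) {F : EReal → ℝ≥0∞}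
    (hF : Measurable F) :
    ∫⁻ w, ∫⁻ l, F (l + ((2 * √γ * (√γ * x + w) : ℝ) : EReal)) ∂awgnLLRLaw g x
        ∂gaussianReal 0 1 = ∫⁻ l, F l ∂awgnLLRLaw (g + γ) x := by
  have hshift : ∀ c : EReal, Measurable fun l => F (l + c) := fun c =>
    hF.comp (measurable_id.add_const c)
  induction g with
  | top =>
    simp only [awgnLLRLaw, top_add, if_true, lintegral_dirac' _ (hshift _), lintegral_dirac' _ hF]
    split_ifs <;> simp only [EReal.top_add_coe, EReal.bot_add, lintegral_const, measure_univ,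
      mul_one]
  | coe g =>
    have hFcoe : Measurable fun u : ℝ => F u := hF.comp measurable_coe_real_ereal
    have hinner : Measurable fun u : ℝ => ∫⁻ l, F ((u + l : ℝ) : EReal)
        ∂gaussianReal (2 * g * x) (4 * g) :=
      (hFcoe.comp (measurable_fst.add measurable_snd)).lintegral_prod_right'
    calc ∫⁻ w, ∫⁻ l, F (l + ((2 * √γ * (√γ * x + w) : ℝ) : EReal)) ∂awgnLLRLaw g x
            ∂gaussianReal 0 1
        = ∫⁻ w, ∫⁻ l, F ((2 * √γ * (√γ * x + w) + l : ℝ) : EReal)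
            ∂gaussianReal (2 * g * x) (4 * g) ∂gaussianReal 0 1 := by
          simp only [awgnLLRLaw_coe, lintegral_map (hshift _) measurable_coe_real_ereal,
            ← EReal.coe_add, add_comm]
      _ = ∫⁻ u, ∫⁻ l, F ((u + l : ℝ) : EReal) ∂gaussianReal (2 * g * x) (4 * g)
            ∂gaussianReal (2 * γ * x) (4 * γ) := by
          rw [← gaussianReal_map_awgnLLR γ x, lintegral_map hinner (by fun_prop)]
      _ = ∫⁻ l, F l ∂awgnLLRLaw (g + γ) x := by
          rw [← Measure.lintegral_conv hFcoe, gaussianReal_conv_gaussianReal, ← ENNReal.coe_add,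
            awgnLLRLaw_coe, lintegral_map hF measurable_coe_real_ereal, add_comm g]
          congr 2
          · push_cast
            ring
          · ring

instance : IsProbabilityMeasure bitLaw := ⟨by simp [bitLaw, ENNReal.inv_two_add_inv_two]⟩

lemma bitLaw_singleton {x : ℝ} (hx : x ∈ ({1, -1} : Finset ℝ)) : bitLaw {x} = 2⁻¹ := by
  simp only [Finset.mem_insert, Finset.mem_singleton] at hx
  rcases hx with rfl | rfl <;> norm_num [bitLaw, indicator]

lemma ae_mem_bitLaw : ∀ᵐ x ∂bitLaw, x ∈ ({1, -1} : Finset ℝ) := by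
  rw [bitLaw, ae_add_measure_iff]
  constructor <;> refine Measure.ae_smul_measure ?_ _ <;> rw [ae_dirac_eq] <;> simp

lemma ae_fst_mem_bitLaw_prod :
    ∀ᵐ p ∂bitLaw.prod (gaussianReal 0 1), p.1 ∈ ({1, -1} : Finset ℝ) :=
  measurePreserving_fst.quasiMeasurePreserving.ae ae_mem_bitLaw

lemma bitLaw_prod_preimage_fst {x : ℝ} (hx : x ∈ ({1, -1} : Finset ℝ)) :
    (bitLaw.prod (gaussianReal 0 1)) (Prod.fst ⁻¹' {x}) = 2⁻¹ := by
  rw [measurePreserving_fst.measure_preimage (measurableSet_singleton x).nullMeasurableSet,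
    bitLaw_singleton hx]

lemma condProb_comap_const {Ω β : Type*} [MeasurableSpace Ω] [MeasurableSpace β] {μ : Measure Ω}
    [IsProbabilityMeasure μ] {s : Set Ω} (hs : MeasurableSet s) (b : β) :
    μ⟦s | MeasurableSpace.comap (fun _ => b) inferInstance⟧ = fun _ => μ.real s := by
  rw [MeasurableSpace.comap_const, condExp_bot]
  simp [integral_indicator_const _ hs]

lemma llr_bitLaw_const :
    _root_.llr (bitLaw.prod (gaussianReal 0 1)) Prod.fst (fun _ => ()) = fun _ => 0 := by
  funext p
  have hset : ∀ x : ℝ, MeasurableSet (Prod.fst ⁻¹' {x} : Set (ℝ × ℝ)) := fun x =>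
    measurable_fst (measurableSet_singleton x)
  rw [_root_.llr, condProb_comap_const (hset 1), condProb_comap_const (hset (-1))]
  simp [Measure.real, bitLaw_prod_preimage_fst, ENNReal.div_self]

lemma ofReal_phi (γ : ℝ≥0∞) : ENNReal.ofReal (phi γ) =
    2⁻¹ * ∑ x ∈ {1, -1}, ∫⁻ l, softError l ∂awgnLLRLaw γ x := by
  induction γ with
  | top =>
    simp only [phi, awgnLLRLaw, if_true, lintegral_dirac' _ measurable_softError]
    norm_num
  | coe γ =>
    have hscalar : phi γ = mmse (bitLaw.prod (gaussianReal 0 1)) Prod.fst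
        (fun p => ((), √γ * p.1 + p.2)) := by
      rw [phi, if_neg ENNReal.coe_ne_top, ENNReal.coe_toReal]
      exact (mmse_comp_of_leftInverse (g' := Prod.snd) measurable_prodMk_left measurable_snd
        fun _ => rfl).symm
    rw [hscalar, ofReal_mmse_gaussianChannel measurable_fst measurable_const
      ae_fst_mem_bitLaw_prod measurable_snd measurePreserving_snd.map_eq
      (indepFun_prod (X := fun x : ℝ => (x, ())) measurable_prodMk_right measurable_id).symm,
      Finset.mul_sum]
    refine Finset.sum_congr rfl fun x hx => ?_
    have hzero : awgnLLRLaw 0 x = Measure.dirac 0 := by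
      rw [← ENNReal.coe_zero, awgnLLRLaw_coe]
      simp
    have hprior : ((bitLaw.prod (gaussianReal 0 1)).restrict (Prod.fst ⁻¹' {x})).map
        (_root_.llr (bitLaw.prod (gaussianReal 0 1)) Prod.fst fun _ => ()) =
          (2⁻¹ : ℝ≥0∞) • awgnLLRLaw 0 x := by
      rw [llr_bitLaw_const, Measure.map_const, Measure.restrict_apply_univ,
        bitLaw_prod_preimage_fst hx, hzero]
    simp only [hprior, lintegral_smul_measure, smul_eq_mul]
    rw [lintegral_const_mul' _ _ (by simp), lintegral_awgnLLRLaw_add 0 γ x measurable_softError,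
      zero_add]

lemma phi_top : phi ⊤ = 0 := if_pos rfl

lemma phi_nonneg (γ : ℝ≥0∞) : 0 ≤ phi γ := by
  rw [phi]
  split_ifs
  exacts [le_rfl, integral_nonneg fun _ => sq_nonneg _]

lemma measurable_phi : Measurable phi := by
  have hgauss : ∀ (x : ℝ) (γ : ℝ≥0), ∫⁻ l, softError l ∂awgnLLRLaw γ x =
      ∫⁻ w, softError ((2 * √γ * (√γ * x + w) : ℝ) : EReal) ∂gaussianReal 0 1 := fun x γ => by
    rw [awgnLLRLaw_coe, lintegral_map measurable_softError measurable_coe_real_ereal,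
      ← gaussianReal_map_awgnLLR]
    exact lintegral_map (measurable_softError.comp measurable_coe_real_ereal) (by fun_prop)
  have hphi : phi = fun γ => (ENNReal.ofReal (phi γ)).toReal :=
    funext fun γ => (ENNReal.toReal_ofReal (phi_nonneg γ)).symm
  rw [hphi]
  refine ENNReal.measurable_toReal.comp (ENNReal.measurable_of_measurable_nnreal ?_)
  simp only [ofReal_phi, hgauss]
  refine (Finset.measurable_sum _ fun x _ => Measurable.lintegral_prod_right' (f :=
    fun p : ℝ≥0 × ℝ => softError ((2 * √p.1 * (√p.1 * x + p.2) : ℝ) : EReal)) ?_).const_mul _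
  exact measurable_softError.comp (measurable_coe_real_ereal.comp (by fun_prop))

lemma sum_negMulLog_condProb_bitLaw (p : ℝ × ℝ) :
    ∑ c ∈ Finset.image (fun (x : ℝ) (_ : Unit) => x) {1, -1},
      Real.negMulLog (((bitLaw.prod (gaussianReal 0 1))⟦
        (fun (p : ℝ × ℝ) (_ : Unit) => p.1) ⁻¹' {c} |
          MeasurableSpace.comap (fun _ => ()) inferInstance⟧) p) = Real.log 2 := by
  have hinj : Function.Injective fun (x : ℝ) (_ : Unit) => x := fun x y h => congrFun h ()
  have hpre : ∀ x : ℝ, (fun (p : ℝ × ℝ) (_ : Unit) => p.1) ⁻¹' {fun _ => x} =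
      Prod.fst ⁻¹' {x} := fun x => by
    ext p
    exact ⟨fun h => congrFun h (), fun h => funext fun _ => h⟩
  have hhalf : ∀ x ∈ ({1, -1} : Finset ℝ),
      (bitLaw.prod (gaussianReal 0 1)).real (Prod.fst ⁻¹' {x}) = 2⁻¹ := fun x hx => by
    simp [Measure.real, bitLaw_prod_preimage_fst hx]
  rw [Finset.sum_image hinj.injOn, Finset.sum_congr rfl fun x hx => by
    rw [hpre, condProb_comap_const (measurable_fst (measurableSet_singleton x)), hhalf x hx]]
  rw [Finset.sum_const, Finset.card_pair (by norm_num), Real.negMulLog, Real.log_inv]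
  ring

lemma lintegral_phi :
    ∫⁻ γ in Ioi (0 : ℝ), ENNReal.ofReal (phi (ENNReal.ofReal γ)) = ENNReal.ofReal (Real.log 4) := by
  let μ := bitLaw.prod (gaussianReal 0 1)
  have hN : μ.map (fun (p : ℝ × ℝ) (_ : Unit) => p.2) = stdGauss Unit := by
    have hpi := (measurePreserving_funUnique (gaussianReal 0 1) Unit).symm
    exact (hpi.comp measurePreserving_snd).map_eq
  have hmain := lintegral_sum_mmse_gaussianChannel (μ := μ) (Z := fun _ => ())
    (C := Finset.image (fun (x : ℝ) (_ : Unit) => x) {1, -1}) (X := fun p _ => p.1) (by fun_prop)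
    (by fun_prop) measurable_const
    (ae_fst_mem_bitLaw_prod.mono fun p hp => Finset.mem_image_of_mem _ hp) hN
    (indepFun_prod (X := fun x : ℝ => (fun _ : Unit => x, ())) (Y := fun (x : ℝ) (_ : Unit) => x)
      (by fun_prop) (by fun_prop)).symm
  have hrecode : ∀ γ : ℝ, 0 < γ → mmse μ (fun p => p.1)
      (fun p => ((), √γ • (fun _ : Unit => p.1) + fun _ => p.2)) = phi (ENNReal.ofReal γ) :=
    fun γ hγ => by
      rw [phi, if_neg ENNReal.ofReal_ne_top, ENNReal.toReal_ofReal hγ.le]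
      exact mmse_comp_of_leftInverse (Y := fun p : ℝ × ℝ => √γ * p.1 + p.2)
        (g := fun y : ℝ => ((), fun _ : Unit => y))
        (g' := fun v => v.2 ()) (by fun_prop) (by fun_prop) fun _ => rfl
  simp only [μ, sum_negMulLog_condProb_bitLaw, Finset.univ_unique, Finset.sum_singleton,
    integral_const, probReal_univ, one_smul] at hmain
  rw [setLIntegral_congr_fun measurableSet_Ioi fun γ hγ => by rw [← hrecode γ hγ], hmain,
    show (4 : ℝ) = 2 ^ 2 by norm_num, Real.log_pow, ENNReal.ofReal_mul (by positivity)]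
  simp

end EquiprobableBit

section TransferCurve

lemma restrict_Iio_top_eq_of_measure_Iio {μ ν : Measure ℝ≥0∞}
    (hfin : ∀ u : ℝ≥0, μ (Iio u) ≠ ⊤) (h : ∀ u : ℝ≥0, μ (Iio u) = ν (Iio u)) :
    μ.restrict (Iio ⊤) = ν.restrict (Iio ⊤) := by
  have hcover : (Iio ⊤ : Set ℝ≥0∞) = ⋃ k : ℕ, Iio ((k : ℝ≥0) : ℝ≥0∞) := by
    ext x
    simp only [mem_Iio, mem_iUnion, ENNReal.coe_natCast]
    exact ⟨fun hx => ENNReal.exists_nat_gt hx.ne, fun ⟨_, hk⟩ => hk.trans_le le_top⟩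
  rw [hcover, Measure.restrict_iUnion_congr]
  intro k
  have : IsFiniteMeasure (μ.restrict (Iio ((k : ℝ≥0) : ℝ≥0∞))) :=
    ⟨by simpa using (hfin k).lt_top⟩
  refine ext_of_generate_finite _ (BorelSpace.measurable_eq.trans
    (borel_eq_generateFrom_Iio _)) isPiSystem_Iio ?_
    (by simpa using h k)
  rintro _ ⟨a, rfl⟩
  obtain ⟨b, hb⟩ : ∃ b : ℝ≥0, (b : ℝ≥0∞) = min a (k : ℝ≥0) :=
    ⟨_, ENNReal.coe_toNNReal (min_lt_of_right_lt ENNReal.coe_lt_top).ne⟩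
  rw [Measure.restrict_apply measurableSet_Iio, Measure.restrict_apply measurableSet_Iio,
    Iio_inter_Iio, ← hb, h b]

/-- The arguments `t > 0` with `γ t + t < u`. -/
def sumSublevel (γ : ℝ → ℝ≥0∞) (u : ℝ) : Set ℝ :=
  {t ∈ Ioi 0 | γ t + ENNReal.ofReal t < ENNReal.ofReal u}

lemma mem_sumSublevel {γ : ℝ → ℝ≥0∞} {t u : ℝ} :
    t ∈ sumSublevel γ u ↔ t ∈ Ioo 0 u ∧ γ t < ENNReal.ofReal (u - t) := by
  simp only [sumSublevel, mem_Ioi, mem_Ioo, and_assoc]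
  refine and_congr_right fun ht => ?_
  rw [ENNReal.ofReal_sub _ ht.le, ← lt_tsub_iff_right]
  refine ⟨fun h => ⟨?_, h⟩, And.right⟩
  exact (ENNReal.ofReal_lt_ofReal_iff_of_nonneg ht.le).1 (tsub_pos_iff_lt.1 (pos_of_gt h))

lemma sumSublevel_subset (γ : ℝ → ℝ≥0∞) (u : ℝ) : sumSublevel γ u ⊆ Ioo 0 u := fun _ ht =>
  (mem_sumSublevel.1 ht).1

lemma volume_sumSublevel_zero (u : ℝ) : volume (sumSublevel 0 u) = ENNReal.ofReal u := by
  have hIoo : sumSublevel 0 u = Ioo 0 u := by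
    ext t
    simp [mem_sumSublevel]
  rw [hIoo, Real.volume_Ioo, sub_zero]

lemma map_add_ofReal_Iio {γ : ℝ → ℝ≥0∞} (hγ : AEMeasurable γ (volume.restrict (Ioi 0))) (u : ℝ≥0) :
    (volume.restrict (Ioi 0)).map (fun t => γ t + ENNReal.ofReal t) (Iio u) =
      volume (sumSublevel γ u) := by
  rw [Measure.map_apply_of_aemeasurable (hγ.fun_add ENNReal.measurable_ofReal.aemeasurable)
    measurableSet_Iio, Measure.restrict_apply' measurableSet_Ioi, inter_comm,
    ← ENNReal.ofReal_coe_nnreal]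
  rfl

variable {γext : ℝ≥0 → ℝ≥0∞} {γap : ℝ → ℝ≥0∞}

lemma exists_isAprioriSNR (hm : Monotone γext) : ∃ γap : ℝ → ℝ≥0∞, IsAprioriSNR γext γap := by
  refine ⟨fun t => sSup {a | ∃ a' : ℝ≥0, a = a' ∧ γext a' ≤ ENNReal.ofReal t},
    fun t _ => ⟨fun a' ha' => ?_, fun a' ha' => ?_⟩⟩
  · obtain ⟨_, ⟨b, rfl, hb⟩, hab⟩ := lt_sSup_iff.1 ha'
    exact (hm (ENNReal.coe_lt_coe.1 hab).le).trans hb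
  · by_contra! hlt
    exact ha'.not_ge (le_sSup ⟨a', rfl, hlt.le⟩)

namespace IsAprioriSNR

lemma monotoneOn (h : IsAprioriSNR γext γap) : MonotoneOn γap (Ici 0) := by
  refine monotoneOn_iff_forall_lt.2 fun t ht t' ht' htt => ?_
  by_contra! hcon
  obtain ⟨a, ha', ha⟩ := ENNReal.lt_iff_exists_nnreal_btwn.1 hcon
  have hle : ENNReal.ofReal t' ≤ ENNReal.ofReal t := ((h t' ht').2 a ha').trans ((h t ht).1 a ha)
  exact htt.not_ge ((ENNReal.ofReal_le_ofReal_iff ht).1 hle)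

lemma aemeasurable (h : IsAprioriSNR γext γap) : AEMeasurable γap (volume.restrict (Ioi 0)) :=
  aemeasurable_restrict_of_monotoneOn measurableSet_Ioi (h.monotoneOn.mono Ioi_subset_Ici_self)

lemma disjoint_sumSublevel (h : IsAprioriSNR γext γap) (u : ℝ) :
    Disjoint (sumSublevel (fun a => γext a.toNNReal) u) ((u - ·) ⁻¹' sumSublevel γap u) := by
  refine disjoint_left.2 fun a ha ht => ?_
  rw [mem_sumSublevel] at ha
  rw [mem_preimage, mem_sumSublevel, sub_sub_cancel] at ht
  exact ha.2.not_ge ((h (u - a) ht.1.1.le).2 a.toNNReal ht.2)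

lemma Ioo_subset_sumSublevel (h : IsAprioriSNR γext γap) {u b : ℝ} (hb : b ∈ Ioo 0 u)
    (hbu : u - b ∉ sumSublevel γap u) : Ioo 0 b ⊆ sumSublevel (fun a => γext a.toNNReal) u := by
  intro a ha
  have hau : u - b < u - a := sub_lt_sub_left ha.2 u
  have hub : 0 < u - b := sub_pos.2 hb.2
  have hle : ENNReal.ofReal b ≤ γap (u - b) := by
    by_contra! hlt
    refine hbu (mem_sumSublevel.2 ⟨⟨hub, sub_lt_self u hb.1⟩, ?_⟩)
    rwa [sub_sub_cancel]
  have hγ : γext a.toNNReal ≤ ENNReal.ofReal (u - b) := (h (u - b) hub.le).1 _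
    (((ENNReal.ofReal_lt_ofReal_iff hb.1).2 ha.2).trans_le hle)
  exact mem_sumSublevel.2 ⟨⟨ha.1, ha.2.trans hb.2⟩,
    hγ.trans_lt ((ENNReal.ofReal_lt_ofReal_iff (hub.trans hau)).2 hau)⟩

lemma subsingleton_Ioo_diff_sumSublevel (h : IsAprioriSNR γext γap) (u : ℝ) :
    (Ioo 0 u \ (sumSublevel (fun a => γext a.toNNReal) u ∪
      (u - ·) ⁻¹' sumSublevel γap u)).Subsingleton := by
  have key : ∀ {a b : ℝ}, a ∈ Ioo 0 u → a ∉ sumSublevel (fun a => γext a.toNNReal) u →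
      b ∈ Ioo 0 u → u - b ∉ sumSublevel γap u → b ≤ a := fun ha ha' hb hb' =>
    le_of_not_gt fun hab => ha' (h.Ioo_subset_sumSublevel hb hb' ⟨ha.1, hab⟩)
  rintro a ⟨ha, ha'⟩ b ⟨hb, hb'⟩
  rw [mem_union, not_or] at ha' hb'
  exact le_antisymm (key hb hb'.1 ha ha'.2) (key ha ha'.1 hb hb'.2)

lemma volume_sumSublevel_add (hm : Monotone γext) (h : IsAprioriSNR γext γap) (u : ℝ) :
    volume (sumSublevel (fun a => γext a.toNNReal) u) + volume (sumSublevel γap u) =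
      ENNReal.ofReal u := by
  set E := sumSublevel (fun a => γext a.toNNReal) u
  set F := (u - ·) ⁻¹' sumSublevel γap u
  have hE : MeasurableSet E := measurableSet_Ioi.inter (measurableSet_lt
    ((hm.measurable.comp measurable_real_toNNReal).add ENNReal.measurable_ofReal)
    measurable_const)
  have hsub : E ∪ F ⊆ Ioo 0 u := by
    refine union_subset (sumSublevel_subset _ u) fun b hb => ?_
    have := sumSublevel_subset _ u hb
    exact ⟨by linarith [this.2], by linarith [this.1]⟩
  have hnull : volume (Ioo 0 u \ (E ∪ F)) = 0 :=
    (h.subsingleton_Ioo_diff_sumSublevel u).measure_zero volume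
  calc volume E + volume (sumSublevel γap u) = volume E + volume F := by
        rw [(volume.measurePreserving_sub_left u).measure_preimage_emb
          (MeasurableEquiv.subLeft u).measurableEmbedding]
    _ = volume (Ioo 0 u) := by
        rw [← measure_union' (h.disjoint_sumSublevel u) hE]
        exact measure_eq_measure_of_null_sdiff hsub hnull
    _ = ENNReal.ofReal u := by simp

lemma lintegral_add (hm : Monotone γext) (h : IsAprioriSNR γext γap)
    {f : ℝ≥0∞ → ℝ≥0∞} (hf : Measurable f) (hf0 : f ⊤ = 0) :
    (∫⁻ a in Ioi (0 : ℝ), f (γext a.toNNReal + ENNReal.ofReal a)) +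
      ∫⁻ t in Ioi (0 : ℝ), f (γap t + ENNReal.ofReal t) =
      ∫⁻ u in Ioi (0 : ℝ), f (ENNReal.ofReal u) := by
  set law := fun T : ℝ → ℝ≥0∞ => (volume.restrict (Ioi 0)).map T
  have hfin : ∀ {T}, AEMeasurable T (volume.restrict (Ioi 0)) →
      ∫⁻ a in Ioi (0 : ℝ), f (T a) = ∫⁻ x in Iio ⊤, f x ∂law T := fun hT => by
    rw [← lintegral_map' hf.aemeasurable hT, ← lintegral_indicator measurableSet_Iio]
    refine lintegral_congr fun x => ?_
    rcases eq_or_ne x ⊤ with rfl | hx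
    · simp [hf0]
    · rw [indicator_of_mem (mem_Iio.2 hx.lt_top)]
  have hid : ∀ u : ℝ≥0, law ENNReal.ofReal (Iio u) = u := fun u => by
    have hzero := map_add_ofReal_Iio (γ := 0) aemeasurable_zero u
    simpa [law, volume_sumSublevel_zero] using hzero
  have hext : AEMeasurable (fun a : ℝ => γext a.toNNReal) (volume.restrict (Ioi 0)) :=
    (hm.measurable.comp measurable_real_toNNReal).aemeasurable
  have hsum : ∀ u : ℝ≥0, law ENNReal.ofReal (Iio u) =
      (law (fun a => γext a.toNNReal + ENNReal.ofReal a) +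
        law fun t => γap t + ENNReal.ofReal t) (Iio u) := fun u => by
    rw [Measure.add_apply, map_add_ofReal_Iio hext, map_add_ofReal_Iio h.aemeasurable,
      h.volume_sumSublevel_add hm, hid, ENNReal.ofReal_coe_nnreal]
  rw [hfin (hext.fun_add ENNReal.measurable_ofReal.aemeasurable),
    hfin (h.aemeasurable.fun_add ENNReal.measurable_ofReal.aemeasurable), hfin (by fun_prop),
    ← lintegral_add_measure, ← Measure.restrict_add,
    ← restrict_Iio_top_eq_of_measure_Iio (fun u => by simp [hid]) hsum]

end IsAprioriSNR

end TransferCurve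

section Bhattacharyya

/-- The Bhattacharyya coefficient `∫ √(F G) dν` of two densities. -/
def bhattacharyya {α : Type*} [MeasurableSpace α] (ν : Measure α) (F G : α → ℝ≥0∞) : ℝ≥0∞ :=
  ∫⁻ x, F x ^ (1 / 2 : ℝ) * G x ^ (1 / 2 : ℝ) ∂ν

lemma bhattacharyya_prod {α β : Type*} [MeasurableSpace α] [MeasurableSpace β] {ν : Measure α}
    {ρ : Measure β} [SFinite ρ] {F G : α × β → ℝ≥0∞} (hF : Measurable F) (hG : Measurable G) :
    bhattacharyya (ν.prod ρ) F G =
      ∫⁻ x, bhattacharyya ρ (fun y => F (x, y)) (fun y => G (x, y)) ∂ν :=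
  lintegral_prod _ (by fun_prop)

section Mehler

variable {ι : Type*} [Fintype ι] {F G : (ι → ℝ) → ℝ≥0∞} {r : ℝ}

/-- The Mehler (Ornstein–Uhlenbeck) operator: it averages `F` over an output degraded by rescaling
with `r` and topping up with independent noise. -/
def mehler (r : ℝ) (F : (ι → ℝ) → ℝ≥0∞) (w : ι → ℝ) : ℝ≥0∞ :=
  ∫⁻ v, F (r • w + √(1 - r ^ 2) • v) ∂stdGauss ι

lemma sq_add_sqrt_one_sub_sq (hr : r ^ 2 ≤ 1) : r ^ 2 + √(1 - r ^ 2) ^ 2 = 1 := by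
  rw [Real.sq_sqrt (sub_nonneg.2 hr)]
  ring

lemma lintegral_mehler (hr : r ^ 2 ≤ 1) (hF : Measurable F) :
    ∫⁻ w, mehler r F w ∂stdGauss ι = ∫⁻ w, F w ∂stdGauss ι :=
  lintegral_stdGauss_rotate (sq_add_sqrt_one_sub_sq hr) hF

lemma mehler_shiftDensity (hr : r ^ 2 ≤ 1) (a w : ι → ℝ) :
    mehler r (fun w => ENNReal.ofReal (shiftDensity a w)) w =
      ENNReal.ofReal (shiftDensity (r • a) w) := by
  have hfactor : ∀ v, shiftDensity a (r • w + √(1 - r ^ 2) • v) =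
      shiftDensity (r • a) w * shiftDensity (√(1 - r ^ 2) • a) v := fun v => by
    unfold shiftDensity
    rw [← Real.exp_add]
    congr 1
    simp only [dotProduct_add, dotProduct_smul, smul_dotProduct, smul_eq_mul]
    linear_combination (a ⬝ᵥ a) / 2 * sq_add_sqrt_one_sub_sq hr
  simp only [mehler, hfactor, ENNReal.ofReal_mul (shiftDensity_pos _ _).le]
  rw [lintegral_const_mul _ (by fun_prop), lintegral_shiftDensity, mul_one]

lemma mehler_sum_mul_shiftDensity (hr : r ^ 2 ≤ 1) {α : Type*} (A : Finset α) (p : α → ℝ≥0∞)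
    (a : α → ι → ℝ) (w : ι → ℝ) :
    mehler r (fun w => ∑ c ∈ A, p c * ENNReal.ofReal (shiftDensity (a c) w)) w =
      ∑ c ∈ A, p c * ENNReal.ofReal (shiftDensity (r • a c) w) := by
  simp only [mehler]
  rw [lintegral_finsetSum _ fun c _ => by fun_prop]
  refine Finset.sum_congr rfl fun c _ => ?_
  rw [lintegral_const_mul _ (by fun_prop)]
  exact congrArg _ (mehler_shiftDensity hr (a c) w)

lemma bhattacharyya_le_mehler (hr : r ^ 2 ≤ 1) (hF : Measurable F) (hG : Measurable G) :
    bhattacharyya (stdGauss ι) F G ≤ bhattacharyya (stdGauss ι) (mehler r F) (mehler r G) := by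
  have hsqrt : ∀ {H : (ι → ℝ) → ℝ≥0∞}, Measurable H → ∀ w, ∫⁻ v,
      (H (r • w + √(1 - r ^ 2) • v) ^ (1 / 2 : ℝ)) ^ (2 : ℝ) ∂stdGauss ι = mehler r H w :=
    fun _ w => lintegral_congr fun v => by rw [← ENNReal.rpow_mul]; norm_num
  rw [bhattacharyya, ← lintegral_mehler hr (by fun_prop)]
  refine lintegral_mono fun w => ?_
  rw [← hsqrt hF w, ← hsqrt hG w]
  exact ENNReal.lintegral_mul_le_Lp_mul_Lq _ Real.HolderConjugate.two_two (by fun_prop)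
    (by fun_prop)

lemma antitoneOn_bhattacharyya_mixture {α : Type*} (A B : Finset α) (p : α → ℝ≥0∞)
    (a : α → ι → ℝ) :
    AntitoneOn (fun s : ℝ => bhattacharyya (stdGauss ι)
      (fun w => ∑ c ∈ A, p c * ENNReal.ofReal (shiftDensity (s • a c) w))
      (fun w => ∑ c ∈ B, p c * ENNReal.ofReal (shiftDensity (s • a c) w))) (Ici 0) := by
  intro s hs s' hs' hss
  obtain ⟨r, hr, rfl⟩ : ∃ r : ℝ, r ^ 2 ≤ 1 ∧ s = r * s' := by
    refine ⟨s / s', ?_, ?_⟩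
    · exact pow_le_one₀ (div_nonneg hs hs') (div_le_one_of_le₀ hss hs')
    · rcases eq_or_ne s' 0 with rfl | hne
      · simpa using le_antisymm hss hs
      · field_simp
  have hmix : ∀ A : Finset α, (fun w => ∑ c ∈ A,
      p c * ENNReal.ofReal (shiftDensity ((r * s') • a c) w)) = mehler r fun w =>
        ∑ c ∈ A, p c * ENNReal.ofReal (shiftDensity (s' • a c) w) := fun A => funext fun w => by
    simp only [mehler_sum_mul_shiftDensity hr, smul_smul]
  simp only [hmix]
  exact bhattacharyya_le_mehler hr (by fun_prop) (by fun_prop)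

end Mehler

lemma mul_rpow_neg_half_div {P Q : ℝ≥0∞} (hP : P ≠ ⊤) :
    P * (P / Q) ^ (-(1 / 2) : ℝ) = P ^ (1 / 2 : ℝ) * Q ^ (1 / 2 : ℝ) := by
  rcases eq_or_ne P 0 with rfl | hP0
  · simp
  have hcancel : P * P ^ (-(1 / 2) : ℝ) = P ^ (1 / 2 : ℝ) := by
    conv_lhs => rw [← ENNReal.rpow_one P, ← ENNReal.rpow_mul, ← ENNReal.rpow_add _ _ hP0 hP]
    norm_num
  rcases eq_or_ne Q 0 with rfl | hQ0
  · simp [ENNReal.div_zero hP0]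
  rw [div_eq_mul_inv, ENNReal.mul_rpow_of_ne_top hP (by simpa using hQ0), ← mul_assoc, hcancel,
    ENNReal.inv_rpow, ENNReal.rpow_neg, inv_inv]

lemma HasJointDensity.lintegral_exp_llr {Ω β : Type*} [MeasurableSpace Ω] [MeasurableSpace β]
    {μ : Measure Ω} [IsFiniteMeasure μ] {B : Ω → ℝ} {V : Ω → β} {ν : Measure β} {f : ℝ → β → ℝ}
    (h : HasJointDensity μ {1, -1} B V ν f) :
    ∫⁻ l, EReal.exp l ^ (-(1 / 2) : ℝ) ∂(μ.restrict (B ⁻¹' {1})).map (_root_.llr μ B V) =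
      bhattacharyya ν (fun v => ENNReal.ofReal (f 1 v)) (fun v => ENNReal.ofReal (f (-1) v)) := by
  have hexp : Measurable fun l : EReal => EReal.exp l ^ (-(1 / 2) : ℝ) :=
    EReal.measurable_exp.pow_const _
  have hratio := measurable_log_div h.measurable
  have hpow : Measurable fun v =>
      (ENNReal.ofReal (f 1 v) / ENNReal.ofReal (f (-1) v)) ^ (-(1 / 2) : ℝ) :=
    ((h.measurable 1).ennreal_ofReal.div (h.measurable (-1)).ennreal_ofReal).pow_const _
  rw [Measure.map_congr (ae_restrict_of_ae h.llr_ae_eq)]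
  calc ∫⁻ l, EReal.exp l ^ (-(1 / 2) : ℝ) ∂(μ.restrict (B ⁻¹' {1})).map (fun ω =>
        ENNReal.log (ENNReal.ofReal (f 1 (V ω)) / ENNReal.ofReal (f (-1) (V ω))))
      = ∫⁻ v, (ENNReal.ofReal (f 1 v) / ENNReal.ofReal (f (-1) v)) ^ (-(1 / 2) : ℝ)
          ∂(μ.restrict (B ⁻¹' {1})).map V := by
        refine (lintegral_map hexp (hratio.comp h.measurable_output)).trans ?_
        simp only [Function.comp_apply, ENNReal.exp_log]
        exact (lintegral_map hpow h.measurable_output).symm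
    _ = bhattacharyya ν (fun v => ENNReal.ofReal (f 1 v)) (fun v => ENNReal.ofReal (f (-1) v)) := by
        rw [h.map_restrict 1 (by simp), lintegral_withDensity_eq_lintegral_mul _
          (h.measurable 1).ennreal_ofReal hpow]
        exact lintegral_congr fun v => mul_rpow_neg_half_div ENNReal.ofReal_ne_top

lemma antitoneOn_lintegral_exp_llr {Ω α β ι : Type*} [MeasurableSpace Ω] [MeasurableSpace α]
    [MeasurableSingletonClass α] [MeasurableSpace β] [Fintype ι] {μ : Measure Ω}
    [IsProbabilityMeasure μ] {C : Finset α} {X : Ω → α} {V : Ω → β} {N : Ω → ι → ℝ} {g : α → ℝ}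
    {a : α → ι → ℝ} (hX : Measurable X) (hV : Measurable V) (hXC : ∀ᵐ ω ∂μ, X ω ∈ C)
    (hg : Measurable g) (hgC : ∀ c ∈ C, g c ∈ ({1, -1} : Finset ℝ)) (ha : Measurable a)
    (hN : Measurable N) (hNlaw : μ.map N = stdGauss ι)
    (hindep : IndepFun N (fun ω => (X ω, V ω)) μ) :
    AntitoneOn (fun s : ℝ => ∫⁻ l, EReal.exp l ^ (-(1 / 2) : ℝ)
      ∂(μ.restrict ((fun ω => g (X ω)) ⁻¹' {1})).map (_root_.llr μ (fun ω => g (X ω))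
        fun ω => (V ω, s • a (X ω) + N ω))) (Ici 0) := by
  obtain ⟨q, hq⟩ := exists_hasJointDensity hX hV hXC
  have hdensity : ∀ (s x : ℝ) (v : β) (w : ι → ℝ), ENNReal.ofReal (∑ c ∈ C with g c = x,
      q c v * shiftDensity (s • a c) w) = ∑ c ∈ C with g c = x,
        ENNReal.ofReal (q c v) * ENNReal.ofReal (shiftDensity (s • a c) w) := fun s x v w => by
    rw [ENNReal.ofReal_sum_of_nonneg fun c _ =>
      mul_nonneg (hq.nonneg c v) (shiftDensity_pos _ _).le]
    exact Finset.sum_congr rfl fun c _ => ENNReal.ofReal_mul (hq.nonneg c v)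
  intro s hs s' hs' hss
  have hout := fun s => (hq.gaussianChannel ha hN hNlaw hindep s).comp hg hgC
  have hbhattacharyya := fun s => (hout s).lintegral_exp_llr.trans (bhattacharyya_prod
    ((hout s).measurable _).ennreal_ofReal ((hout s).measurable _).ennreal_ofReal)
  simp only [hbhattacharyya, hdensity]
  exact lintegral_mono fun v => antitoneOn_bhattacharyya_mixture _ _ _ a hs hs' hss

lemma lintegral_exp_awgnLLRLaw (g : ℝ≥0∞) :
    ∫⁻ l, EReal.exp l ^ (-(1 / 2) : ℝ) ∂awgnLLRLaw g 1 = EReal.exp g ^ (-(1 / 2) : ℝ) := by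
  have hmeas : Measurable fun l : EReal => EReal.exp l ^ (-(1 / 2) : ℝ) :=
    EReal.measurable_exp.pow_const _
  have hcoe : ∀ x : ℝ, EReal.exp (x : EReal) ^ (-(1 / 2) : ℝ) =
      ENNReal.ofReal (Real.exp (-(1 / 2) * x)) := fun x => by
    rw [EReal.exp_coe, ENNReal.ofReal_rpow_of_pos (Real.exp_pos _), ← Real.exp_mul, mul_comm]
  induction g with
  | top => simp [awgnLLRLaw]
  | coe g =>
    have hmgf := congrFun (mgf_id_gaussianReal (μ := 2 * g * 1) (v := 4 * g)) (-(1 / 2))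
    simp only [mgf, id] at hmgf
    rw [awgnLLRLaw_coe, lintegral_map hmeas measurable_coe_real_ereal]
    simp only [hcoe]
    rw [← ofReal_integral_eq_lintegral_ofReal (integrable_exp_mul_gaussianReal _)
      (ae_of_all _ fun x => (Real.exp_pos _).le), hmgf]
    refine Eq.trans ?_ (hcoe g).symm
    congr 2
    push_cast
    ring

lemma rpow_exp_le_rpow_exp_iff {g g' : ℝ≥0∞} :
    EReal.exp g' ^ (-(1 / 2) : ℝ) ≤ EReal.exp g ^ (-(1 / 2) : ℝ) ↔ g ≤ g' := by
  rw [ENNReal.rpow_neg, ENNReal.rpow_neg, ENNReal.inv_le_inv,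
    ENNReal.rpow_le_rpow_iff (by norm_num), EReal.exp_le_exp_iff,
    EReal.coe_ennreal_le_coe_ennreal_iff]

end Bhattacharyya

section DropCoord

variable {ι : Type*}

/-- Restriction of a vector to the coordinates other than `k`. -/
def dropCoord (k : ι) (c : ι → ℝ) : {j // j ≠ k} → ℝ := fun j => c j

@[fun_prop]
lemma measurable_dropCoord (k : ι) : Measurable (dropCoord k) := by
  unfold dropCoord
  fun_prop

lemma measurePreserving_eval_dropCoord [Fintype ι] [DecidableEq ι] (k : ι) :
    MeasurePreserving (fun w : ι → ℝ => (w k, dropCoord k w)) (stdGauss ι)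
      ((gaussianReal 0 1).prod (stdGauss {j // j ≠ k})) :=
  Measure.measurePreserving_swap.comp (((MeasurePreserving.id _).prod (measurePreserving_eval
    (fun _ : {i // ¬ i ≠ k} => gaussianReal 0 1) ⟨k, not_not.2 rfl⟩)).comp
      (measurePreserving_piEquivPiSubtypeProd (fun _ : ι => gaussianReal 0 1) (· ≠ k)))

end DropCoord

section CodedTransmission

variable {Ω β : Type*} [MeasurableSpace Ω] [MeasurableSpace β] {μ : Measure Ω}

lemma indepFun_prodMk_of_indepFun_prodMk {γ δ : Type*} [MeasurableSpace γ] [MeasurableSpace δ]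
    [IsFiniteMeasure μ] {f : Ω → β} {g : Ω → γ} {h : Ω → δ} (hf : Measurable f)
    (hg : Measurable g) (hh : Measurable h) (hfg : IndepFun f g μ)
    (hfgh : IndepFun (fun ω => (f ω, g ω)) h μ) : IndepFun f (fun ω => (g ω, h ω)) μ := by
  have hgh : IndepFun g h μ := hfgh.comp measurable_snd measurable_id
  have hf' := hf.aemeasurable (μ := μ)
  have hg' := hg.aemeasurable (μ := μ)
  have hh' := hh.aemeasurable (μ := μ)
  rw [indepFun_iff_map_prod_eq_prod_map_map (by fun_prop) (by fun_prop)] at *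
  rw [hgh, ← Measure.prodAssoc_prod, ← hfg, ← hfgh,
    Measure.map_map MeasurableEquiv.prodAssoc.measurable (by fun_prop)]
  rfl

/-- Transmission of a codeword `X` of a code `C ⊆ {1, -1}ⁿ` whose bits are equiprobable: `Z` is the
channel observation, and `N` the standard Gaussian noise of the a priori channel. Of the law of the
codeword, only its support and the laws of the single bits are prescribed. -/
structure IsCodedTransmission {n : ℕ} (μ : Measure Ω) (C : Finset (Fin n → ℝ))
    (X N : Ω → Fin n → ℝ) (Z : Ω → β) : Prop where
  measurable_codeword : Measurable X
  measurable_noise : Measurable N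
  measurable_observation : Measurable Z
  bit_mem : ∀ c ∈ C, ∀ k, c k ∈ ({1, -1} : Finset ℝ)
  codeword_mem : ∀ᵐ ω ∂μ, X ω ∈ C
  measure_bit_eq_one : ∀ k, μ {ω | X ω k = 1} = 2⁻¹
  map_noise : μ.map N = stdGauss (Fin n)
  indepFun : IndepFun N (fun ω => (X ω, Z ω)) μ

lemma ae_mem_of_map_eq_uniformOn {α : Type*} [MeasurableSpace α] [MeasurableSingletonClass α]
    {X : Ω → α} (hX : Measurable X) {C : Finset α} (hlaw : μ.map X = uniformOn (C : Set α)) :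
    ∀ᵐ ω ∂μ, X ω ∈ C := by
  refine ae_of_ae_map hX.aemeasurable (p := (· ∈ C)) ?_
  rw [hlaw, uniformOn]
  exact ae_cond_mem C.measurableSet

variable {n : ℕ} {C : Finset (Fin n → ℝ)} {X N : Ω → Fin n → ℝ}
  {Z : Ω → β} {γext : ℝ≥0 → ℝ≥0∞}

namespace IsCodedTransmission

lemma measurable_bit (h : IsCodedTransmission μ C X N Z) (k : Fin n) :
    Measurable fun ω => X ω k := (measurable_pi_apply k).comp h.measurable_codeword

lemma ae_bit_mem (h : IsCodedTransmission μ C X N Z) (k : Fin n) :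
    ∀ᵐ ω ∂μ, X ω k ∈ ({1, -1} : Finset ℝ) :=
  h.codeword_mem.mono fun _ hω => h.bit_mem _ hω k

lemma measurePreserving_noise (h : IsCodedTransmission μ C X N Z) :
    MeasurePreserving N μ (stdGauss (Fin n)) := ⟨h.measurable_noise, h.map_noise⟩

lemma map_eval_dropCoord_noise (h : IsCodedTransmission μ C X N Z) (k : Fin n) :
    μ.map (fun ω => (N ω k, dropCoord k (N ω))) =
      (gaussianReal 0 1).prod (stdGauss {j // j ≠ k}) :=
  ((measurePreserving_eval_dropCoord k).comp h.measurePreserving_noise).map_eq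

lemma map_eval_noise (h : IsCodedTransmission μ C X N Z) (k : Fin n) :
    μ.map (fun ω => N ω k) = gaussianReal 0 1 :=
  ((measurePreserving_eval (fun _ => gaussianReal 0 1) k).comp h.measurePreserving_noise).map_eq

lemma map_dropCoord_noise (h : IsCodedTransmission μ C X N Z) (k : Fin n) :
    μ.map (fun ω => dropCoord k (N ω)) = stdGauss {j // j ≠ k} :=
  ((measurePreserving_snd.comp (measurePreserving_eval_dropCoord k)).comp
    h.measurePreserving_noise).map_eq

variable [IsProbabilityMeasure μ]

lemma measure_bit_eq (h : IsCodedTransmission μ C X N Z) (k : Fin n) {x : ℝ}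
    (hx : x ∈ ({1, -1} : Finset ℝ)) : μ {ω | X ω k = x} = 2⁻¹ := by
  simp only [Finset.mem_insert, Finset.mem_singleton] at hx
  rcases hx with rfl | rfl
  · exact h.measure_bit_eq_one k
  · have hset : MeasurableSet {ω | X ω k = 1} := h.measurable_bit k (measurableSet_singleton 1)
    have hcompl : ({ω | X ω k = -1} : Set Ω) =ᵐ[μ] ({ω | X ω k = 1}ᶜ : Set Ω) := by
      filter_upwards [h.ae_bit_mem k] with ω hω
      simp only [Finset.mem_insert, Finset.mem_singleton] at hω
      refine propext (show X ω k = -1 ↔ ¬ X ω k = 1 from ?_)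
      rcases hω with hω | hω <;> rw [hω] <;> norm_num
    rw [measure_congr hcompl, prob_compl_eq_one_sub hset, h.measure_bit_eq_one,
      ENNReal.one_sub_inv_two]

lemma sum_map_extrinsicLLR (h : IsCodedTransmission μ C X N Z)
    (hext : GaussianExtrinsic μ X N Z γext) (γ : ℝ≥0) {x : ℝ} (hx : x ∈ ({1, -1} : Finset ℝ)) :
    ∑ k, (μ.restrict ((fun ω => X ω k) ⁻¹' {x})).map (extrinsicLLR μ X (awgn X N γ) Z k) =
      (n * 2⁻¹ : ℝ≥0∞) • awgnLLRLaw (γext γ) x := by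
  have hcond : ∀ k, (ProbabilityTheory.cond μ {ω | X ω k = x}).map
      (extrinsicLLR μ X (awgn X N γ) Z k) = (2 : ℝ≥0∞) •
        (μ.restrict ((fun ω => X ω k) ⁻¹' {x})).map (extrinsicLLR μ X (awgn X N γ) Z k) :=
    fun k => by
      rw [ProbabilityTheory.cond, h.measure_bit_eq k hx, inv_inv, Measure.map_smul]
      rfl
  rw [← hext γ x (by simpa using hx), extrinsicLLRLaw]
  simp only [hcond, ← Finset.smul_sum, smul_smul]
  obtain rfl | hn := eq_or_ne n 0
  · simp
  rw [mul_mul_mul_comm, ENNReal.mul_inv_cancel (by exact_mod_cast hn) (by simp),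
    ENNReal.inv_mul_cancel two_ne_zero (by simp), mul_one, one_smul]

lemma indepFun_eval_noise_extrinsic (h : IsCodedTransmission μ C X N Z) (k : Fin n) (s : ℝ) :
    IndepFun (fun ω => N ω k)
      (fun ω => (X ω k, (Z ω, s • dropCoord k (X ω) + dropCoord k (N ω)))) μ := by
  have hN := h.measurable_noise
  have hnoise : IndepFun (fun ω => N ω k) (fun ω => dropCoord k (N ω)) μ := by
    rw [indepFun_iff_map_prod_eq_prod_map_map (by fun_prop) (by fun_prop),
      h.map_eval_dropCoord_noise, h.map_eval_noise, h.map_dropCoord_noise]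
  have hinput := h.indepFun.comp (φ := fun w => (w k, dropCoord k w)) (by fun_prop) measurable_id
  exact (indepFun_prodMk_of_indepFun_prodMk (by fun_prop) (by fun_prop)
    (h.measurable_codeword.prodMk h.measurable_observation) hnoise hinput).comp measurable_id
    (ψ := fun v => (v.2.1 k, (v.2.2, s • dropCoord k v.2.1 + v.1))) (by fun_prop)

end IsCodedTransmission

end CodedTransmission

section TransferFunction

variable {Ω β : Type*} [MeasurableSpace Ω] [MeasurableSpace β] {μ : Measure Ω} {n : ℕ}
  {C : Finset (Fin n → ℝ)} {X N : Ω → Fin n → ℝ} {Z : Ω → β} {γext : ℝ≥0 → ℝ≥0∞}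

lemma awgnLLRLaw_univ (γ : ℝ≥0∞) (x : ℝ) : awgnLLRLaw γ x univ = 1 := by
  induction γ with
  | top => simp [awgnLLRLaw]
  | coe γ => rw [awgnLLRLaw_coe, Measure.map_apply measurable_coe_real_ereal .univ, preimage_univ,
      measure_univ]

lemma GaussianExtrinsic.ne_zero (hext : GaussianExtrinsic μ X N Z γext) : n ≠ 0 := by
  rintro rfl
  have hmass := congrArg (fun ρ : Measure EReal => ρ univ) (hext 0 1 (.inl rfl))
  simp [extrinsicLLRLaw, awgnLLRLaw_univ] at hmass

namespace IsCodedTransmission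

variable [IsProbabilityMeasure μ]

lemma sum_lintegral_extrinsicLLR (h : IsCodedTransmission μ C X N Z)
    (hext : GaussianExtrinsic μ X N Z γext) (γ : ℝ≥0) {x : ℝ} (hx : x ∈ ({1, -1} : Finset ℝ))
    (F : EReal → ℝ≥0∞) :
    ∑ k, ∫⁻ l, F l
        ∂(μ.restrict ((fun ω => X ω k) ⁻¹' {x})).map (extrinsicLLR μ X (awgn X N γ) Z k) =
      n * 2⁻¹ * ∫⁻ l, F l ∂awgnLLRLaw (γext γ) x := by
  rw [← lintegral_finsetSum_measure, h.sum_map_extrinsicLLR hext γ hx, lintegral_smul_measure,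
    smul_eq_mul]

lemma antitone_lintegral_exp_extrinsicLLR (h : IsCodedTransmission μ C X N Z) (k : Fin n) :
    Antitone fun γ : ℝ≥0 => ∫⁻ l, EReal.exp l ^ (-(1 / 2) : ℝ)
      ∂(μ.restrict ((fun ω => X ω k) ⁻¹' {1})).map (extrinsicLLR μ X (awgn X N γ) Z k) := by
  intro γ γ' hγ
  have hN := h.measurable_noise
  have hanti := antitoneOn_lintegral_exp_llr (g := fun c => c k) (a := dropCoord k)
    (N := fun ω => dropCoord k (N ω)) h.measurable_codeword h.measurable_observation
    h.codeword_mem (measurable_pi_apply k) (fun c hc => h.bit_mem c hc k) (by fun_prop)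
    (by fun_prop) (h.map_dropCoord_noise k)
    (h.indepFun.comp (measurable_dropCoord k) measurable_id)
  exact hanti (Real.sqrt_nonneg γ) (Real.sqrt_nonneg γ')
    (Real.sqrt_le_sqrt (NNReal.coe_le_coe.2 hγ))

lemma monotone_of_gaussianExtrinsic (h : IsCodedTransmission μ C X N Z)
    (hext : GaussianExtrinsic μ X N Z γext) : Monotone γext := by
  intro γ γ' hγ
  have hn : (n * 2⁻¹ : ℝ≥0∞) ≠ 0 := by simpa using hext.ne_zero
  have hle := Finset.sum_le_sum fun k (_ : k ∈ Finset.univ) =>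
    h.antitone_lintegral_exp_extrinsicLLR k hγ
  simp only [h.sum_lintegral_extrinsicLLR hext _ (Finset.mem_insert_self _ _),
    lintegral_exp_awgnLLRLaw] at hle
  exact rpow_exp_le_rpow_exp_iff.1 ((ENNReal.mul_le_mul_iff_right hn
    (ENNReal.mul_ne_top (by simp) (by simp))).1 hle)

lemma ofReal_mmse_bit (h : IsCodedTransmission μ C X N Z) (k : Fin n) (γ : ℝ≥0) :
    ENNReal.ofReal (mmse μ (fun ω => X ω k) (fun ω => (Z ω, √γ • X ω + N ω))) =
      ∑ x ∈ {1, -1}, ∫⁻ w, ∫⁻ l, softError (l + ((2 * √γ * (√γ * x + w) : ℝ) : EReal))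
        ∂(μ.restrict ((fun ω => X ω k) ⁻¹' {x})).map (extrinsicLLR μ X (awgn X N γ) Z k)
        ∂gaussianReal 0 1 := by
  have hX := h.measurable_codeword
  have hN := h.measurable_noise
  have hZ := h.measurable_observation
  have hmerge : Measurable fun u : (β × ({j // j ≠ k} → ℝ)) × ℝ =>
      (u.1.1, fun j => if hj : j ≠ k then u.1.2 ⟨j, hj⟩ else u.2) := by
    refine measurable_fst.fst.prodMk (measurable_pi_lambda _ fun j => ?_)
    split_ifs <;> fun_prop
  rw [← mmse_comp_of_leftInverse (Y := fun ω => (Z ω, √γ • X ω + N ω))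
    (g := fun v => ((v.1, dropCoord k v.2), v.2 k)) (by fun_prop) hmerge fun v => by
      refine Prod.ext rfl (funext fun j => ?_)
      by_cases hj : j = k <;> simp [hj, dropCoord]]
  exact ofReal_mmse_gaussianChannel (h.measurable_bit k) (by fun_prop) (h.ae_bit_mem k)
    (by fun_prop) (h.map_eval_noise k) (h.indepFun_eval_noise_extrinsic k √γ) √γ

lemma sum_ofReal_mmse_bit (h : IsCodedTransmission μ C X N Z)
    (hext : GaussianExtrinsic μ X N Z γext) (γ : ℝ≥0) :
    ∑ k, ENNReal.ofReal (mmse μ (fun ω => X ω k) (fun ω => (Z ω, √γ • X ω + N ω))) =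
      n * ENNReal.ofReal (phi (γext γ + γ)) := by
  have hmeas : ∀ x : ℝ, Measurable fun p : ℝ × EReal =>
      softError (p.2 + ((2 * √γ * (√γ * x + p.1) : ℝ) : EReal)) := fun x =>
    measurable_softError.comp (measurable_snd.add (by fun_prop))
  have hbit : ∀ x ∈ ({1, -1} : Finset ℝ), ∑ k, ∫⁻ w, ∫⁻ l,
        softError (l + ((2 * √γ * (√γ * x + w) : ℝ) : EReal))
        ∂(μ.restrict ((fun ω => X ω k) ⁻¹' {x})).map (extrinsicLLR μ X (awgn X N γ) Z k)
        ∂gaussianReal 0 1 = n * 2⁻¹ * ∫⁻ l, softError l ∂awgnLLRLaw (γext γ + γ) x := by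
    intro x hx
    rw [← lintegral_finsetSum _ fun k _ => (hmeas x).lintegral_prod_right',
      ← lintegral_awgnLLRLaw_add _ _ _ measurable_softError,
      ← lintegral_const_mul' _ _ (ENNReal.mul_ne_top (by simp) (by simp))]
    exact lintegral_congr fun w => h.sum_lintegral_extrinsicLLR hext γ hx _
  simp only [h.ofReal_mmse_bit]
  rw [Finset.sum_comm, Finset.sum_congr rfl hbit, ← Finset.mul_sum, mul_assoc, ofReal_phi]

end IsCodedTransmission

end TransferFunction

section OuterRate

variable {Ω β : Type*} [MeasurableSpace Ω] [MeasurableSpace β] {μ : Measure Ω}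
  [IsProbabilityMeasure μ] {n : ℕ} {C : Finset (Fin n → ℝ)} {X N : Ω → Fin n → ℝ} {Z : Ω → β}
  {γext : ℝ≥0 → ℝ≥0∞} {γap : ℝ → ℝ≥0∞}

lemma IsAprioriSNR.integrableOn_phi_add (hap : IsAprioriSNR γext γap) (hm : Monotone γext) :
    IntegrableOn (fun t : ℝ => phi (γap t + ENNReal.ofReal t)) (Ioi 0) := by
  refine ⟨(measurable_phi.comp_aemeasurable (hap.aemeasurable.add
    ENNReal.measurable_ofReal.aemeasurable)).aestronglyMeasurable, ?_⟩
  have harea := hap.lintegral_add hm measurable_phi.ennreal_ofReal (by simp [phi_top])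
  rw [hasFiniteIntegral_iff_ofReal (ae_of_all _ fun t => phi_nonneg _)]
  refine lt_of_le_of_lt (le_add_self.trans harea.le) ?_
  rw [lintegral_phi]
  exact ENNReal.ofReal_lt_top

lemma condEntropyBits_nonneg {α : Type*} [MeasurableSpace α] [MeasurableSingletonClass α]
    {X : Ω → α} (hX : Measurable X) (hZ : Measurable Z) (C : Finset α) :
    0 ≤ condEntropyBits μ C X Z := by
  refine div_nonneg (integral_nonneg_of_ae ?_) (Real.log_nonneg one_le_two)
  have hprob : ∀ c, ∀ᵐ ω ∂μ,
      (μ⟦X ⁻¹' {c} | MeasurableSpace.comap Z inferInstance⟧) ω ∈ Icc 0 1 := fun c => by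
    have hind : Integrable ((X ⁻¹' {c}).indicator fun _ => (1 : ℝ)) μ :=
      (integrable_const 1).indicator (hX (measurableSet_singleton c))
    have hle := condExp_mono (m := MeasurableSpace.comap Z inferInstance) hind
      (integrable_const (1 : ℝ)) (ae_of_all _ (indicator_le_self' fun _ _ => zero_le_one))
    rw [condExp_const hZ.comap_le] at hle
    filter_upwards [hle, condExp_nonneg (m := MeasurableSpace.comap Z inferInstance)
      (ae_of_all μ (indicator_nonneg (s := X ⁻¹' {c}) fun _ _ => zero_le_one (α := ℝ)))]
      with ω hle hnonneg using ⟨hnonneg, hle⟩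
  filter_upwards [(Filter.eventually_all_finset C).2 fun c _ => hprob c] with ω hω
  exact Finset.sum_nonneg fun c hc => Real.negMulLog_nonneg (hω c hc).1 (hω c hc).2

lemma IsCodedTransmission.lintegral_phi_add (h : IsCodedTransmission μ C X N Z)
    (hext : GaussianExtrinsic μ X N Z γext) :
    n * ∫⁻ a in Ioi (0 : ℝ), ENNReal.ofReal (phi (γext a.toNNReal + ENNReal.ofReal a)) =
      2 * ENNReal.ofReal (condEntropyBits μ C X Z * Real.log 2) := by
  rw [condEntropyBits, div_mul_cancel₀ _ (Real.log_pos one_lt_two).ne',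
    ← lintegral_sum_mmse_gaussianChannel h.measurable_codeword h.measurable_noise
      h.measurable_observation h.codeword_mem h.map_noise h.indepFun,
    ← lintegral_const_mul' _ _ (by simp)]
  refine setLIntegral_congr_fun measurableSet_Ioi fun a ha => ?_
  have hsum := h.sum_ofReal_mmse_bit hext a.toNNReal
  rw [Real.coe_toNNReal a (le_of_lt ha)] at hsum
  exact hsum.symm

lemma IsCodedTransmission.maxOuterRate_eq (h : IsCodedTransmission μ C X N Z)
    (hext : GaussianExtrinsic μ X N Z γext) (hap : IsAprioriSNR γext γap) :
    maxOuterRate μ C X Z =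
      (∫ t in Ioi (0 : ℝ), phi (γap t + ENNReal.ofReal t)) / Real.log 4 := by
  have hm := h.monotone_of_gaussianExtrinsic hext
  have hn : (n : ℝ) ≠ 0 := Nat.cast_ne_zero.2 hext.ne_zero
  have hlog4 : Real.log 4 = 2 * Real.log 2 := by
    rw [show (4 : ℝ) = 2 ^ 2 by norm_num, Real.log_pow, Nat.cast_ofNat]
  have hH : 0 ≤ condEntropyBits μ C X Z :=
    condEntropyBits_nonneg h.measurable_codeword h.measurable_observation C
  have harea := hap.lintegral_add hm measurable_phi.ennreal_ofReal (by simp [phi_top])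
  have hentropy := congrArg ENNReal.toReal (h.lintegral_phi_add hext)
  rw [lintegral_phi, ← ofReal_integral_eq_lintegral_ofReal (hap.integrableOn_phi_add hm)
    (ae_of_all _ fun t => phi_nonneg _)] at harea
  have hfin := ne_top_of_le_ne_top ENNReal.ofReal_ne_top (le_self_add.trans harea.le)
  have htotal := congrArg ENNReal.toReal harea
  rw [ENNReal.toReal_add hfin ENNReal.ofReal_ne_top, ENNReal.toReal_ofReal
    (integral_nonneg fun t => phi_nonneg _), ENNReal.toReal_ofReal (by positivity)] at htotal
  rw [ENNReal.toReal_mul, ENNReal.toReal_mul, ENNReal.toReal_natCast, ENNReal.toReal_ofNat,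
    ENNReal.toReal_ofReal (by positivity)] at hentropy
  rw [maxOuterRate, eq_div_iff (by positivity)]
  rw [hlog4] at htotal ⊢
  field_simp
  linear_combination hentropy - n * htotal

end OuterRate

theorem lemma3_general {Ω β : Type*} [MeasurableSpace Ω] [MeasurableSpace β] {μ : Measure Ω}
    [IsProbabilityMeasure μ] {n : ℕ} {C : Finset (Fin n → ℝ)} {X N : Ω → Fin n → ℝ} {Z : Ω → β}
    {γext : ℝ≥0 → ℝ≥0∞} (h : IsCodedTransmission μ C X N Z)
    (hext : GaussianExtrinsic μ X N Z γext) :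
    (∃ γap : ℝ → ℝ≥0∞, IsAprioriSNR γext γap) ∧
    ∀ γap : ℝ → ℝ≥0∞, IsAprioriSNR γext γap →
      IntegrableOn (fun t : ℝ => phi (γap t + ENNReal.ofReal t)) (Ioi 0) ∧
      maxOuterRate μ C X Z =
        (∫ t in Ioi (0 : ℝ), phi (γap t + ENNReal.ofReal t)) / Real.log 4 :=
  have hm := h.monotone_of_gaussianExtrinsic hext
  ⟨exists_isAprioriSNR hm, fun _ hap => ⟨hap.integrableOn_phi_add hm, h.maxOuterRate_eq hext hap⟩⟩

end

theorem lemma3 {Ω β : Type*} [MeasurableSpace Ω] [MeasurableSpace β]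
    (μ : Measure Ω) [IsProbabilityMeasure μ]
    (n : ℕ) (hn : 0 < n)
    (C : Finset (Fin n → ℝ)) (hC : ∀ c ∈ C, ∀ i, c i = 1 ∨ c i = -1)
    (X N : Ω → Fin n → ℝ) (Z : Ω → β)
    (hX : Measurable X) (hN : Measurable N) (hZ : Measurable Z)
    -- the codeword is uniform on the code, and its bits are equiprobable
    (hXlaw : μ.map X = uniformOn (C : Set (Fin n → ℝ)))
    (hbit : ∀ k, μ {ω | X ω k = 1} = 2⁻¹)
    -- the noise of the a priori channel
    (hNlaw : μ.map N = Measure.pi (fun _ => gaussianReal 0 1))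
    (hindep : IndepFun N (fun ω => (X ω, Z ω)) μ)
    (γext : ℝ≥0 → ℝ≥0∞) (hext : GaussianExtrinsic μ X N Z γext) :
    (∃ γap : ℝ → ℝ≥0∞, IsAprioriSNR γext γap) ∧
    ∀ γap : ℝ → ℝ≥0∞, IsAprioriSNR γext γap →
      IntegrableOn (fun t : ℝ => phi (γap t + ENNReal.ofReal t)) (Set.Ioi 0) ∧
      maxOuterRate μ C X Z =
        (∫ t in Set.Ioi (0 : ℝ), phi (γap t + ENNReal.ofReal t)) / Real.log 4 := by
  exact lemma3_general ⟨hX, hN, hZ, fun c hc k => by simpa using hC c hc k,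
    ae_mem_of_map_eq_uniformOn hX hXlaw, hbit, hNlaw, hindep⟩ hext
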